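/- Let $A$ and $E$ be quantum systems of dimensions $d_A\ge 2$ and $d_E\ge 1$, identified with $\mathbb C^{d_A}$ and $\mathbb C^{d_E}$. A measure-and-prepare channel on $A$ is a map $\mathcal M(\rho)=\sum_{j=1}^m \mathrm{Tr}(F_j\rho)\,\sigma_j$, where $(F_j)$ is a POVM on $A$ and the $\sigma_j$ are states of $A$. Given $N$ copies of an unknown state $\rho$ of $AE$ and an observable $X$ on $AE$, the measure-and-prepare mean-estimation procedure works as follows. An ensemble, consisting of a probability distribution $p$ on a set of labels and a (measurable) family $(\mathcal M_z)$ of measure-and-prepare channels on $A$, is fixed independently of $\rho$ and $X$. In each round $k=1,\dots,N$, independently, one draws $z_k\sim p$, prepares $(\mathcal M_{z_k}\otimes \mathrm{id}_E)(\rho)$ from a fresh copy of $\rho$, and measures $X$ on it, obtaining an outcome $x_k\in\mathrm{spec}(X)$. A (possibly randomized) classical post-processing, which may depend on $X$, then produces an estimate $\hat\mu\in\mathbb R$ from $(z_1,x_1),\dots,(z_N,x_N)$. For given $\varepsilon,\delta>0$ the procedure succeeds for the observable $X$ if, for every state $\rho$ of $AE$, $|\hat\mu-\mathrm{Tr}(X\rho)|\le\varepsilon$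 with probability at least $1-\delta$. **Theorem.** For every $\delta\in(0,\tfrac12)$ there are constants $c,C>0$, depending only on $\delta$, such that the following holds for all $d_A\ge 2$ and $d_E\ge 1$. 1. (Necessity.) For every ensemble $(p,(\mathcal M_z))$ of measure-and-prepare channels on $A$ there is a rank-1 projector $X$ on $AE$ such that for every $\varepsilon\in(0,\tfrac12)$, every $N$ and every classical post-processing: if the procedure succeeds for $X$ with $N$ copies, then $N\ge c\,d_A$. 2. (Sufficiency.) Let $$\mathcal M_0(\rho)=d_A\,\mathbb E_\theta\big[\langle v_\theta|\rho|v_\theta\rangle\,|v_\theta\rangle\langle v_\theta|\big],\qquad \mathcal M_1(\rho)=\frac1{d_A-1}\sum_{k\ne l}\langle k|\rho|k\rangle\,|l\rangle\langle l|,$$ where $|v_\theta\rangle=d_A^{-1/2}\sum_j e^{i\theta_j}|j\rangle$ with $\theta_1,\dots,\theta_{d_A}$ independent and uniform in $[0,2\pi)$, and let $p(0)=\frac{d_A}{2d_A-1}$, $p(1)=\frac{d_A-1}{2d_A-1}$. Then $\mathcal M_0,\mathcal M_1$ are measure-and-prepare channels and $p$ is a probability distribution, and for every rank-1 projector $X$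 on $AE$, every $\varepsilon>0$ and every $N\ge C\,d_A/\varepsilon^{2}$, the procedure with this ensemble and the post-processing $\hat\mu=\frac1N\sum_{k=1}^N(2d_A-1)(-1)^{z_k}x_k$ succeeds for $X$ with $N$ copies. In particular, for constant $\varepsilon\in(0,\tfrac12)$ and $\delta\in(0,\tfrac12)$, $N=\Theta(d_A)$ copies are necessary and sufficient, and the ensemble in 2 is sample-optimal with respect to $d_A$. -/

import Mathlib

open MeasureTheory ProbabilityTheory
open scoped ComplexOrder

noncomputable section

namespace TimeLikeCut

/-- Square complex matrices indexed by `n`, i.e. the operators on `ℂⁿ`. -/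
abbrev Op (n : Type*) := Matrix n n ℂ

/-- A quantum state: a positive semidefinite operator of unit trace. -/
def IsDensity {n : Type*} [Fintype n] (ρ : Op n) : Prop :=
  ρ.PosSemidef ∧ ρ.trace = 1

/-- `X` is an orthogonal projection of rank one. -/
structure IsRankOneProj {n : Type*} [Fintype n] [DecidableEq n] (X : Op n) : Prop where
  isHermitian : X.IsHermitian
  idem : X * X = X
  rank_eq_one : X.rank = 1

/-- A measure-and-prepare channel: measure a POVM `F` and, upon outcome `j`, prepare the
state `σ j`. -/
def IsMeasurePrepare {n : Type*} [Fintype n] [DecidableEq n] (Φ : Op n → Op n) : Prop :=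
  ∃ (m : ℕ) (F σ : Fin m → Op n),
    (∀ j, (F j).PosSemidef) ∧ ∑ j, F j = 1 ∧ (∀ j, IsDensity (σ j)) ∧
      ∀ ρ, Φ ρ = ∑ j, (F j * ρ).trace • σ j

/-- The map `Φ ⊗ id_E`, for `Φ` linear: `Φ` is applied to every `A`-block
`(1 ⊗ ⟨e|) ρ (1 ⊗ |e'⟩)` of the operator `ρ` on `A ⊗ E`. -/
def tensorId {a e : Type*} (Φ : Op a → Op a) (ρ : Op (a × e)) : Op (a × e) :=
  Matrix.of fun x y => Φ (Matrix.of fun i j => ρ (i, x.2) (j, y.2)) x.1 y.1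

/-- An ensemble of measure-and-prepare channels: a probability distribution `p` on labels `z`
and a (measurable) family of measure-and-prepare channels `M z`. -/
structure IsMPEnsemble {Z n : Type*} [MeasurableSpace Z] [Fintype n] [DecidableEq n]
    (p : Measure Z) (M : Z → Op n → Op n) : Prop where
  isProbabilityMeasure : IsProbabilityMeasure p
  isMeasurePrepare : ∀ z, IsMeasurePrepare (M z)
  measurable : ∀ ρ i j, Measurable fun z => M z ρ i j

/-- Law of the outcome of measuring the observable `X` in the state `σ`: the eigenvalue `λᵢ`
is observed with weight `⟨vᵢ, σ vᵢ⟩`, for an orthonormal eigenbasis `vᵢ` of `X`. -/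
def outcomeLaw {n : Type*} [Fintype n] [DecidableEq n] {X : Op n} (hX : X.IsHermitian)
    (σ : Op n) : Measure ℝ :=
  ∑ i, ENNReal.ofReal
      (star ⇑(hX.eigenvectorBasis i) ⬝ᵥ (σ.mulVec ⇑(hX.eigenvectorBasis i))).re •
    Measure.dirac (hX.eigenvalues i)

/-- Law of the data `(z, x)` of one round: draw `z ∼ p`, apply `M z ⊗ id_E` to `ρ`, and let
`x` be the outcome of measuring `X`. -/
def roundLaw {Z a e : Type*} [MeasurableSpace Z] [Fintype a] [DecidableEq a] [Fintype e]
    [DecidableEq e] (p : Measure Z) (M : Z → Op a → Op a) {X : Op (a × e)}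
    (hX : X.IsHermitian) (ρ : Op (a × e)) : Measure (Z × ℝ) :=
  p.bind fun z => (outcomeLaw hX (tensorId (M z) ρ)).map fun x => (z, x)

/-- Law of the estimate: the (possibly randomized) classical post-processing `post` is applied
to the data of `N` independent rounds. -/
def estimateLaw {Z a e : Type*} [MeasurableSpace Z] [Fintype a] [DecidableEq a] [Fintype e]
    [DecidableEq e] (p : Measure Z) (M : Z → Op a → Op a) {X : Op (a × e)}
    (hX : X.IsHermitian) (N : ℕ) (post : Kernel (Fin N → Z × ℝ) ℝ) (ρ : Op (a × e)) :
    Measure ℝ :=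
  (Measure.pi fun _ : Fin N => roundLaw p M hX ρ).bind post

/-- For every state `ρ`, the estimate is within `ε` of `Tr(X ρ)` with probability at least
`1 - δ`. -/
def Succeeds {Z a e : Type*} [MeasurableSpace Z] [Fintype a] [DecidableEq a] [Fintype e]
    [DecidableEq e] (p : Measure Z) (M : Z → Op a → Op a) {X : Op (a × e)}
    (hX : X.IsHermitian) (N : ℕ) (post : Kernel (Fin N → Z × ℝ) ℝ) (ε δ : ℝ) : Prop :=
  ∀ ρ : Op (a × e), IsDensity ρ →
    ENNReal.ofReal (1 - δ) ≤
      estimateLaw p M hX N post ρ {μ | |μ - (X * ρ).trace.re| ≤ ε}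

/-- The equatorial vector `v_θ = d^{-1/2} ∑ⱼ e^{i θⱼ} |j⟩`. -/
def equatorial {d : ℕ} (θ : Fin d → ℝ) : Fin d → ℂ :=
  fun j => Complex.exp (θ j * Complex.I) / (Real.sqrt d : ℂ)

/-- The projection `|v_θ⟩⟨v_θ|`. -/
def equatorialProj {d : ℕ} (θ : Fin d → ℝ) : Op (Fin d) :=
  Matrix.vecMulVec (equatorial θ) (star (equatorial θ))

/-- `ρ ↦ d · E_θ Tr(|v_θ⟩⟨v_θ| ρ) |v_θ⟩⟨v_θ|`, the angles being independent and uniform in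
`[0, 2π)`; the expectation is taken entrywise. -/
def channelZero (d : ℕ) (ρ : Op (Fin d)) : Op (Fin d) :=
  Matrix.of fun i j =>
    (d : ℂ) * ⨍ θ in Set.univ.pi (fun _ : Fin d => Set.Ico (0 : ℝ) (2 * Real.pi)),
      (equatorialProj θ * ρ).trace * equatorialProj θ i j

/-- `ρ ↦ (d - 1)⁻¹ ∑_{k ≠ l} Tr(|k⟩⟨k| ρ) |l⟩⟨l|`. -/
def channelOne (d : ℕ) (ρ : Op (Fin d)) : Op (Fin d) :=
  ((d : ℂ) - 1)⁻¹ • ∑ kl ∈ (Finset.univ : Finset (Fin d)).offDiag,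
    (Matrix.single kl.1 kl.1 (1 : ℂ) * ρ).trace • Matrix.single kl.2 kl.2 (1 : ℂ)

/-- The two channels of the optimal time-like cut of the identity. -/
def cutChannel (d : ℕ) : Fin 2 → Op (Fin d) → Op (Fin d) :=
  ![channelZero d, channelOne d]

/-- The sampling distribution of the optimal cut: label `0` with probability `d / (2d - 1)`
and label `1` with probability `(d - 1) / (2d - 1)`. -/
def cutDist (d : ℕ) : Measure (Fin 2) :=
  ENNReal.ofReal ((d : ℝ) / (2 * d - 1)) • Measure.dirac 0 +
    ENNReal.ofReal (((d : ℝ) - 1) / (2 * d - 1)) • Measure.dirac 1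

/-- The empirical mean over the `N` rounds of `(2d - 1) (-1)^z x`. -/
def empiricalMean (d N : ℕ) (w : Fin N → Fin 2 × ℝ) : ℝ :=
  (∑ k, (2 * (d : ℝ) - 1) * (-1) ^ ((w k).1 : ℕ) * (w k).2) / N

theorem measurable_empiricalMean (d N : ℕ) : Measurable (empiricalMean d N) := by
  unfold empiricalMean
  refine Measurable.div_const (Finset.measurable_sum _ fun k _ => ?_) _
  have h1 : Measurable fun w : Fin N → Fin 2 × ℝ => ((-1 : ℝ) ^ ((w k).1 : ℕ)) :=
    (measurable_of_countable fun z : Fin 2 => (-1 : ℝ) ^ (z : ℕ)).comp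
      (measurable_fst.comp (measurable_pi_apply k))
  exact (h1.const_mul _).mul (measurable_snd.comp (measurable_pi_apply k))

/-- The empirical mean as a (deterministic) classical post-processing. -/
def meanPost (d N : ℕ) : Kernel (Fin N → Fin 2 × ℝ) ℝ :=
  Kernel.deterministic (empiricalMean d N) (measurable_empiricalMean d N)

end TimeLikeCut

end

/-! Both halves rest on the fourth moments of independent phases (`phaseMoment`): averaging `Tr(P_θ
ρ) P_θ` over equatorial projections gives `d⁻² (Tr ρ · 1 + ρ - diag ρ)`. Only phase exponents
between -2 and 2 occur, so cube roots of unity have the same moments as the full circle, and the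
average is an exact finite one over `3 ^ d` phase strings.

Necessity. Take `X = P ⊗ Q` with `P` equatorial, and compare the states `P ⊗ Q` and `complState P ⊗
Q`, whose expectation values are 1 and 0. For a measure-and-prepare channel, the probability of
outcome 1, averaged over `P`, is at most `2 / d` in either state (`sum_hit_le`), so some `P` has
total at most `4 / d` after averaging over the ensemble. The two round laws then share a part of
mass at least `1 - 4 / d`, all with outcome 0. After `N` rounds the shared mass is at least `1 - 4 N
/ d` by Bernoulli, while success forces it to be at most `2 δ` (`Succeeds.pow_le`).

Sufficiency. The moment formula gives `d M₀ = T + id - D` and `(d - 1) M₁ = T - D`, with `T` the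
unnormalized depolarizing map and `D` dephasing, so `id = d M₀ - (d - 1) M₁`. The estimator is
therefore unbiased (`integral_roundEstimate`). Its naive variance bound is of order `d²`, but for
rank-one `X` the outcome 1 is rare enough to leave `6 d` (`variance_roundEstimate_le`), and
Chebyshev finishes. -/

namespace TimeLikeCut

open Matrix Kronecker

/-! ### Positivity, conditional operators and the law of measuring a projection -/

section LinearAlgebra

variable {n a e : Type*} [Fintype n] [Fintype a]

theorem exists_eq_conjTranspose_mul_self {A : Op n} (hA : A.PosSemidef) :
    ∃ B : Op n, A = Bᴴ * B := by
  classical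
  open scoped MatrixOrder Matrix.Norms.L2Operator in
  exact CStarAlgebra.nonneg_iff_eq_star_mul_self.mp hA.nonneg

theorem trace_mul_nonneg {A B : Op n} (hA : A.PosSemidef) (hB : B.PosSemidef) :
    0 ≤ (A * B).trace := by
  obtain ⟨C, rfl⟩ := exists_eq_conjTranspose_mul_self hA
  rw [Matrix.mul_assoc, Matrix.trace_mul_comm]
  exact (hB.mul_mul_conjTranspose_same C).trace_nonneg

theorem IsDensity.trace_re {σ : Op n} (hσ : IsDensity σ) : σ.trace.re = 1 := by
  simp [hσ.2]

/-- A density operator is bounded by the identity. -/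
theorem IsDensity.one_sub_posSemidef [DecidableEq n] {σ : Op n} (hσ : IsDensity σ) :
    (1 - σ).PosSemidef := by
  have hH := hσ.1.isHermitian
  have hle : ∀ i, hH.eigenvalues i ≤ 1 := fun i => by
    have htr := hH.trace_eq_sum_eigenvalues
    rw [hσ.2] at htr
    have h1 : (1 : ℝ) = ∑ i, hH.eigenvalues i := by
      have := congrArg Complex.re htr
      simpa using this
    rw [h1]
    exact Finset.single_le_sum (fun j _ => hσ.1.eigenvalues_nonneg j) (Finset.mem_univ i)
  have hdiag : (Matrix.diagonal fun i => ((1 - hH.eigenvalues i : ℝ) : ℂ)).PosSemidef := by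
    refine Matrix.PosSemidef.diagonal fun i => ?_
    exact Complex.zero_le_real.mpr (sub_nonneg.mpr (hle i))
  have h := hdiag.mul_mul_conjTranspose_same (hH.eigenvectorUnitary : Op n)
  convert h using 1
  have hs := hH.spectral_theorem
  rw [Unitary.conjStarAlgAut_apply] at hs
  have hd : (Matrix.diagonal fun i => ((1 - hH.eigenvalues i : ℝ) : ℂ))
      = 1 - Matrix.diagonal (RCLike.ofReal ∘ hH.eigenvalues) := by
    rw [← Matrix.diagonal_one, Matrix.diagonal_sub]
    congr 1
    ext i
    simp
  rw [hd, Matrix.mul_sub, Matrix.sub_mul, ← Matrix.star_eq_conjTranspose, Matrix.mul_one]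
  rw [← Unitary.coe_star, Unitary.coe_mul_star_self, Unitary.coe_star]
  exact congrArg (1 - ·) hs

theorem trace_mul_le {A σ : Op n} (hA : A.PosSemidef) (hσ : IsDensity σ) :
    (A * σ).trace.re ≤ A.trace.re := by
  classical
  have h := trace_mul_nonneg hA hσ.one_sub_posSemidef
  rw [Matrix.mul_sub, Matrix.mul_one, Matrix.trace_sub] at h
  have := (Complex.le_def.mp h).1
  simp at this
  linarith

/-- The operator `Tr_A[(F ⊗ 1) ρ]` on `E`. -/
def condBlock (F : Op a) (ρ : Op (a × e)) : Op e :=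
  Matrix.of fun y y' => (F * Matrix.of fun i j => ρ (i, y) (j, y')).trace

/-- With `F = Cᴴ C`, each row `c` of `C` gives a Kraus operator `K_c : A ⊗ E → E`, and the block is
`∑ K_c ρ K_cᴴ`. -/
theorem condBlock_posSemidef [Fintype e] {F : Op a} {ρ : Op (a × e)} (hF : F.PosSemidef)
    (hρ : ρ.PosSemidef) : (condBlock F ρ).PosSemidef := by
  classical
  obtain ⟨C, rfl⟩ := exists_eq_conjTranspose_mul_self hF
  have h : condBlock (Cᴴ * C) ρ = ∑ c, (Matrix.of fun (y : e) (x : a × e) =>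
      if y = x.2 then C c x.1 else 0) * ρ * (Matrix.of fun (y : e) (x : a × e) =>
      if y = x.2 then C c x.1 else 0)ᴴ := by
    ext y y'
    rw [condBlock, Matrix.of_apply, Matrix.mul_assoc, Matrix.trace_mul_comm, Matrix.sum_apply]
    refine Finset.sum_congr rfl fun c _ => ?_
    simp only [Matrix.diag_apply, Matrix.mul_apply, Matrix.of_apply, Matrix.conjTranspose_apply,
      Fintype.sum_prod_type, apply_ite star, star_zero, mul_ite, mul_zero, ite_mul, zero_mul]
    simp
  rw [h]
  exact Matrix.posSemidef_sum _ fun c _ => hρ.mul_mul_conjTranspose_same _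

theorem condBlock_sum {ι : Type*} (s : Finset ι) (F : ι → Op a) (ρ : Op (a × e)) :
    condBlock (∑ i ∈ s, F i) ρ = ∑ i ∈ s, condBlock (F i) ρ := by
  ext y y'
  simp [condBlock, Matrix.sum_apply, Finset.sum_mul, Matrix.trace_sum]

theorem trace_condBlock_one [Fintype e] [DecidableEq a] (ρ : Op (a × e)) :
    (condBlock 1 ρ).trace = ρ.trace := by
  simp only [condBlock, Matrix.one_mul, Matrix.trace, Matrix.diag_apply, Matrix.of_apply]
  rw [Fintype.sum_prod_type, Finset.sum_comm]

theorem condBlock_one_isDensity [Fintype e] [DecidableEq a] {ρ : Op (a × e)} (hρ : IsDensity ρ) :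
    IsDensity (condBlock 1 ρ) :=
  ⟨condBlock_posSemidef .one hρ.1, by rw [trace_condBlock_one, hρ.2]⟩

/-- No positivity is needed, so this also serves maps that are not channels, such as `traceOne`. -/
theorem tensorId_eq_sum {ι : Type*} [Fintype ι] {F σ : ι → Op a} {Φ : Op a → Op a}
    (hΦ : ∀ ρ, Φ ρ = ∑ j, (F j * ρ).trace • σ j) (ρ : Op (a × e)) :
    tensorId Φ ρ = ∑ j, σ j ⊗ₖ condBlock (F j) ρ := by
  ext x y
  simp [tensorId, hΦ, Matrix.sum_apply, condBlock, mul_comm]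

theorem IsMeasurePrepare.tensorId_isDensity [Fintype e] [DecidableEq a] {Φ : Op a → Op a}
    (hΦ : IsMeasurePrepare Φ) {ρ : Op (a × e)} (hρ : IsDensity ρ) :
    IsDensity (tensorId Φ ρ) := by
  obtain ⟨m, F, σ, hF, hF1, hσ, h⟩ := hΦ
  rw [tensorId_eq_sum h]
  refine ⟨Matrix.posSemidef_sum _ fun j _ =>
    (hσ j).1.kronecker (condBlock_posSemidef (hF j) hρ.1), ?_⟩
  simp only [Matrix.trace_sum, Matrix.trace_kronecker, (hσ _).2, one_mul]
  rw [← Matrix.trace_sum, ← condBlock_sum, hF1, trace_condBlock_one, hρ.2]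

theorem IsMeasurePrepare.of_fintype [DecidableEq a] {ι : Type*} [Fintype ι] {Φ : Op a → Op a}
    (F σ : ι → Op a) (hF : ∀ j, (F j).PosSemidef) (hF1 : ∑ j, F j = 1)
    (hσ : ∀ j, IsDensity (σ j)) (hΦ : ∀ ρ, Φ ρ = ∑ j, (F j * ρ).trace • σ j) :
    IsMeasurePrepare Φ := by
  let f := (Fintype.equivFin ι).symm
  refine ⟨Fintype.card ι, F ∘ f, σ ∘ f, fun j => hF _, ?_, fun j => hσ _, fun ρ => ?_⟩
  · rw [← hF1]
    exact f.sum_comp F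
  · rw [hΦ]
    exact (f.sum_comp fun j => (F j * ρ).trace • σ j).symm

variable [DecidableEq n]

theorem IsRankOneProj.posSemidef {X : Op n} (hX : IsRankOneProj X) : X.PosSemidef := by
  have := Matrix.posSemidef_conjTranspose_mul_self X
  rwa [hX.isHermitian.eq, hX.idem] at this

theorem eigenvalues_eq_zero_or_one {X : Op n} (hX : X.IsHermitian) (hX2 : X * X = X) (i : n) :
    hX.eigenvalues i = 0 ∨ hX.eigenvalues i = 1 := by
  have h1 := hX.mulVec_eigenvectorBasis i
  have h2 : X.mulVec (X.mulVec ⇑(hX.eigenvectorBasis i)) = X.mulVec ⇑(hX.eigenvectorBasis i) := by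
    rw [Matrix.mulVec_mulVec, hX2]
  rw [h1, Matrix.mulVec_smul, h1, smul_smul] at h2
  have hne : (⇑(hX.eigenvectorBasis i) : n → ℂ) ≠ 0 := fun h0 => by
    have := hX.eigenvectorBasis.toBasis.ne_zero i
    apply this
    ext j
    simpa using congrFun h0 j
  have h3 := smul_left_injective ℝ hne h2
  have h4 : hX.eigenvalues i * (hX.eigenvalues i - 1) = 0 := by
    linear_combination h3
  rcases mul_eq_zero.mp h4 with h | h
  · exact .inl h
  · exact .inr (by linarith)

/-- The trace of an orthogonal projection is its rank. -/
theorem trace_eq_rank {X : Op n} (hX : X.IsHermitian) (hX2 : X * X = X) :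
    X.trace = X.rank := by
  rw [hX.rank_eq_card_non_zero_eigs, Fintype.card_subtype, hX.trace_eq_sum_eigenvalues,
    ← Finset.sum_boole]
  refine Finset.sum_congr rfl fun i _ => ?_
  rcases eigenvalues_eq_zero_or_one hX hX2 i with h | h <;> simp [h]

theorem IsRankOneProj.trace_eq_one {X : Op n} (hX : IsRankOneProj X) : X.trace = 1 := by
  rw [trace_eq_rank hX.isHermitian hX.idem, hX.rank_eq_one, Nat.cast_one]

theorem IsRankOneProj.isDensity {X : Op n} (hX : IsRankOneProj X) : IsDensity X :=
  ⟨hX.posSemidef, hX.trace_eq_one⟩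

theorem isRankOneProj_vecMulVec {v : n → ℂ} (hv : star v ⬝ᵥ v = 1) :
    IsRankOneProj (Matrix.vecMulVec v (star v)) := by
  have hH := (Matrix.posSemidef_vecMulVec_self_star v).isHermitian
  have hI : Matrix.vecMulVec v (star v) * Matrix.vecMulVec v (star v) =
      Matrix.vecMulVec v (star v) := by
    rw [Matrix.vecMulVec_mul_vecMulVec, hv]
    simp
  refine ⟨hH, hI, ?_⟩
  have h := trace_eq_rank hH hI
  rw [Matrix.trace_vecMulVec, dotProduct_comm, hv] at h
  exact_mod_cast h.symm

/-- Expectation value of a Hermitian operator through its eigenbasis. -/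
theorem trace_mul_eq_sum_eigenvalues {X : Op n} (hX : X.IsHermitian) (σ : Op n) :
    (X * σ).trace = ∑ i, (hX.eigenvalues i : ℂ) *
      (star ⇑(hX.eigenvectorBasis i) ⬝ᵥ (σ.mulVec ⇑(hX.eigenvectorBasis i))) := by
  have hs := hX.spectral_theorem
  rw [Unitary.conjStarAlgAut_apply] at hs
  conv_lhs => rw [hs]
  rw [Matrix.mul_assoc, Matrix.mul_assoc, Matrix.trace_mul_comm, Matrix.mul_assoc,
    Matrix.trace]
  refine Finset.sum_congr rfl fun i _ => ?_
  rw [Matrix.diag_apply, Matrix.diagonal_mul, Matrix.mul_assoc]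
  rfl

theorem trace_eq_sum_eigenvectorBasis {X : Op n} (hX : X.IsHermitian) (σ : Op n) :
    σ.trace = ∑ i, (star ⇑(hX.eigenvectorBasis i) ⬝ᵥ (σ.mulVec ⇑(hX.eigenvectorBasis i))) := by
  have h : σ.trace = (star (hX.eigenvectorUnitary : Op n) *
      (σ * (hX.eigenvectorUnitary : Op n))).trace := by
    rw [Matrix.trace_mul_comm, Matrix.mul_assoc, ← Unitary.coe_star, Unitary.coe_mul_star_self,
      Matrix.mul_one]
  rw [h]
  rfl

/-- Measuring a projection yields `1` with probability `Tr(Xσ)` and `0` otherwise. -/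
theorem outcomeLaw_eq {X : Op n} (hX : X.IsHermitian) (hX2 : X * X = X) {σ : Op n}
    (hσ : IsDensity σ) :
    outcomeLaw hX σ = ENNReal.ofReal (1 - (X * σ).trace.re) • Measure.dirac 0 +
      ENNReal.ofReal (X * σ).trace.re • Measure.dirac 1 := by
  set c : n → ℝ := fun i =>
    (star ⇑(hX.eigenvectorBasis i) ⬝ᵥ (σ.mulVec ⇑(hX.eigenvectorBasis i))).re with hc
  have hc0 : ∀ i, 0 ≤ c i := fun i => hσ.1.re_dotProduct_nonneg _
  have hc1 : ∑ i, c i = 1 := by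
    rw [← hσ.trace_re, trace_eq_sum_eigenvectorBasis hX σ, Complex.re_sum]
  have hcq : (X * σ).trace.re = ∑ i, c i * hX.eigenvalues i := by
    rw [trace_mul_eq_sum_eigenvalues hX, Complex.re_sum]
    refine Finset.sum_congr rfl fun i _ => ?_
    rw [Complex.re_ofReal_mul, mul_comm]
  -- Both weights become sums over the same eigenbasis, so the measures can be compared term by
  -- term, each eigenvalue being 0 or 1.
  have hcq' : 1 - (X * σ).trace.re = ∑ i, c i * (1 - hX.eigenvalues i) := by
    simp_rw [mul_sub, mul_one]
    rw [Finset.sum_sub_distrib, hc1, hcq]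
  have hnn : ∀ i, 0 ≤ hX.eigenvalues i ∧ 0 ≤ 1 - hX.eigenvalues i := fun i => by
    rcases eigenvalues_eq_zero_or_one hX hX2 i with h | h <;> simp [h]
  rw [hcq', hcq, ENNReal.ofReal_sum_of_nonneg fun i _ => mul_nonneg (hc0 i) (hnn i).2,
    ENNReal.ofReal_sum_of_nonneg fun i _ => mul_nonneg (hc0 i) (hnn i).1, Finset.sum_smul,
    Finset.sum_smul, ← Finset.sum_add_distrib, outcomeLaw]
  refine Finset.sum_congr rfl fun i _ => ?_
  rcases eigenvalues_eq_zero_or_one hX hX2 i with h | h <;> simp [h, hc]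

end LinearAlgebra

/-! ### Fourth moments of phases and the equatorial channel -/

section Phases

variable {d : ℕ}

/-- The exponent of `u m` in `u k * conj (u l) * u i * conj (u j)` for phases `u`. -/
def phaseExponent (k l i j m : Fin d) : ℤ :=
  (if m = k then 1 else 0) - (if m = l then 1 else 0) + (if m = i then 1 else 0) -
    (if m = j then 1 else 0)

/-- The only nonzero multiples of 3 lie outside this range, which is why cube roots of unity
suffice. -/
theorem phaseExponent_mem (k l i j m : Fin d) :
    -2 ≤ phaseExponent k l i j m ∧ phaseExponent k l i j m ≤ 2 := by
  unfold phaseExponent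
  split_ifs <;> omega

/-- All phases cancel exactly when the unconjugated indices `k, i` pair off with the conjugated `l,
j`. -/
theorem phaseExponent_eq_zero_iff (k l i j : Fin d) :
    (∀ m, phaseExponent k l i j m = 0) ↔ (k = l ∧ i = j) ∨ (k = j ∧ l = i) := by
  unfold phaseExponent
  constructor
  · intro h
    have hk := h k
    have hi := h i
    have hl := h l
    grind
  · rintro (⟨rfl, rfl⟩ | ⟨rfl, rfl⟩) m <;> ring

/-- The fourth moments `E[u k * conj (u l) * u i * conj (u j)]` of independent phases. -/
def phaseMoment (k l i j : Fin d) : ℂ :=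
  if (k = l ∧ i = j) ∨ (k = j ∧ l = i) then 1 else 0

/-- Independence factorizes the moment over coordinates; `c` is 3 for the discrete sum and `2π` for
the integral. -/
theorem prod_phaseExponent (c : ℂ) (k l i j : Fin d) :
    ∏ m, (if phaseExponent k l i j m = 0 then c else 0) = c ^ d * phaseMoment k l i j := by
  unfold phaseMoment
  simp_rw [← phaseExponent_eq_zero_iff]
  split_ifs with h
  · simp [h]
  · push Not at h
    obtain ⟨m, hm⟩ := h
    rw [mul_zero]
    exact Finset.prod_eq_zero (Finset.mem_univ m) (if_neg hm)

theorem equatorialProj_apply (θ : Fin d → ℝ) (k l : Fin d) :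
    equatorialProj θ k l =
      Complex.exp (θ k * Complex.I) * Complex.exp (-(θ l * Complex.I)) / d := by
  have hd : ((Real.sqrt d : ℝ) : ℂ) * (Real.sqrt d : ℝ) = d := by
    rw [← Complex.ofReal_mul, Real.mul_self_sqrt (Nat.cast_nonneg d), Complex.ofReal_natCast]
  rw [equatorialProj, Matrix.vecMulVec_apply, Pi.star_apply, equatorial, equatorial,
    Complex.star_def, map_div₀, Complex.conj_ofReal, ← Complex.exp_conj, div_mul_div_comm, hd]
  simp

theorem equatorialProj_mul_apply (θ : Fin d → ℝ) (k l i j : Fin d) :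
    equatorialProj θ k l * equatorialProj θ i j =
      (d : ℂ)⁻¹ ^ 2 * ∏ m, Complex.exp (phaseExponent k l i j m * (θ m * Complex.I)) := by
  rw [equatorialProj_apply, equatorialProj_apply, ← Complex.exp_sum]
  have h : ∑ m, (phaseExponent k l i j m : ℂ) * (θ m * Complex.I) =
      θ k * Complex.I + -(θ l * Complex.I) + θ i * Complex.I + -(θ j * Complex.I) := by
    unfold phaseExponent
    push_cast
    simp only [add_mul, sub_mul, Finset.sum_add_distrib, Finset.sum_sub_distrib, ite_mul, one_mul,
      zero_mul, Finset.sum_ite_eq', Finset.mem_univ, if_true]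
    ring
  rw [h, Complex.exp_add, Complex.exp_add, Complex.exp_add]
  ring

/-- The angles `2πs/3` with `s` in `{0, 1, 2}`. -/
noncomputable def thirdAngle (s : Fin d → Fin 3) : Fin d → ℝ := fun m => 2 * Real.pi * (s m : ℕ) / 3

theorem sum_exp_third {n : ℤ} (h1 : -2 ≤ n) (h2 : n ≤ 2) :
    ∑ t : Fin 3, Complex.exp (n * (((2 * Real.pi * (t : ℕ) / 3 : ℝ) : ℂ) * Complex.I)) =
      if n = 0 then 3 else 0 := by
  split_ifs with h
  · simp [h]
  · set w := Complex.exp (n * (2 * Real.pi * Complex.I / 3)) with hw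
    have hpow : ∀ t : ℕ, Complex.exp (n * (((2 * Real.pi * (t : ℕ) / 3 : ℝ) : ℂ) * Complex.I))
        = w ^ t := fun t => by
      rw [hw, ← Complex.exp_nat_mul]
      congr 1
      push_cast
      ring
    have h3 : w ^ 3 = 1 := by
      rw [hw, ← Complex.exp_nat_mul, Complex.exp_eq_one_iff]
      exact ⟨n, by push_cast; ring⟩
    have hne : w - 1 ≠ 0 := fun h0 => by
      obtain ⟨k, hk⟩ := Complex.exp_eq_one_iff.mp (sub_eq_zero.mp h0)
      have hpi : (2 * Real.pi * Complex.I : ℂ) ≠ 0 := Complex.two_pi_I_ne_zero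
      have hk' : (n : ℂ) = ((3 * k : ℤ) : ℂ) := by
        apply mul_right_cancel₀ hpi
        push_cast
        linear_combination 3 * hk
      have : n = 3 * k := by exact_mod_cast hk'
      -- A nonzero `n` in `[-2, 2]` is not a multiple of 3.
      omega
    simp_rw [hpow, Fin.sum_univ_three]
    apply mul_left_cancel₀ hne
    simp only [Fin.val_zero, Fin.val_one, Fin.val_two]
    -- Geometric sum: `(w - 1)(1 + w + w²) = w³ - 1 = 0`.
    linear_combination h3

theorem integral_exp_circle (n : ℤ) :
    ∫ t in Set.Ico (0 : ℝ) (2 * Real.pi), Complex.exp (n * ((t : ℂ) * Complex.I)) =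
      if n = 0 then ((2 * Real.pi : ℝ) : ℂ) else 0 := by
  rw [integral_Ico_eq_integral_Ioc, ← intervalIntegral.integral_of_le Real.two_pi_pos.le]
  split_ifs with h
  · simp [h]
  · have hc : (n * Complex.I : ℂ) ≠ 0 := mul_ne_zero (by exact_mod_cast h) Complex.I_ne_zero
    have := integral_exp_mul_complex (a := 0) (b := 2 * Real.pi) hc
    have he : Complex.exp (n * Complex.I * (2 * Real.pi : ℝ)) = 1 :=
      Complex.exp_eq_one_iff.mpr ⟨n, by push_cast; ring⟩
    rw [he] at this
    simp only [Complex.ofReal_zero, mul_zero, Complex.exp_zero, sub_self, zero_div] at this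
    rw [← this]
    congr 1
    ext t
    congr 1
    ring

theorem sum_equatorialProj_mul (k l i j : Fin d) :
    ∑ s : Fin d → Fin 3, equatorialProj (thirdAngle s) k l * equatorialProj (thirdAngle s) i j =
      (d : ℂ)⁻¹ ^ 2 * (3 ^ d * phaseMoment k l i j) := by
  simp_rw [equatorialProj_mul_apply]
  rw [← Finset.mul_sum, ← prod_phaseExponent]
  congr 1
  simp_rw [← sum_exp_third (phaseExponent_mem k l i j _).1 (phaseExponent_mem k l i j _).2]
  rw [Finset.prod_univ_sum, Fintype.piFinset_univ]
  rfl

/-- The cube of angles `[0, 2π)^d`. -/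
abbrev angleCube (d : ℕ) : Set (Fin d → ℝ) :=
  Set.univ.pi (fun _ : Fin d => Set.Ico (0 : ℝ) (2 * Real.pi))

theorem volume_angleCube (d : ℕ) :
    volume.restrict (angleCube d) =
      Measure.pi fun _ : Fin d => volume.restrict (Set.Ico (0 : ℝ) (2 * Real.pi)) := by
  rw [volume_pi, Measure.restrict_pi_pi]

theorem volume_real_angleCube (d : ℕ) : volume.real (angleCube d) = (2 * Real.pi) ^ d := by
  rw [measureReal_def, volume_pi, Measure.pi_pi]
  simp [Real.volume_Ico, Real.pi_pos.le]

theorem integrableOn_equatorialProj_mul (k l i j : Fin d) :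
    IntegrableOn (fun θ => equatorialProj θ k l * equatorialProj θ i j) (angleCube d) := by
  simp_rw [equatorialProj_mul_apply]
  refine Integrable.const_mul ?_ _
  rw [volume_angleCube]
  refine Integrable.fintype_prod (f := fun m (t : ℝ) =>
    Complex.exp (phaseExponent k l i j m * ((t : ℂ) * Complex.I))) fun m => ?_
  refine ((Continuous.integrableOn_Icc ?_).mono_set Set.Ico_subset_Icc_self)
  fun_prop

theorem average_equatorialProj_mul (k l i j : Fin d) :
    ⨍ θ in angleCube d, equatorialProj θ k l * equatorialProj θ i j =
      (d : ℂ)⁻¹ ^ 2 * phaseMoment k l i j := by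
  rw [setAverage_eq, volume_real_angleCube]
  simp_rw [equatorialProj_mul_apply]
  rw [integral_const_mul, volume_angleCube,
    integral_fintype_prod_eq_prod (fun m (t : ℝ) =>
      Complex.exp (phaseExponent k l i j m * ((t : ℂ) * Complex.I)))]
  simp_rw [integral_exp_circle]
  rw [prod_phaseExponent, Complex.real_smul]
  have : (Real.pi : ℂ) ≠ 0 := by exact_mod_cast Real.pi_ne_zero
  push_cast
  field_simp

/-- Inclusion–exclusion over the two pairings, which overlap when all four indices agree; the
overlap is the source of the `- diag ρ` term. -/
theorem phaseMoment_eq (k l i j : Fin d) :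
    phaseMoment k l i j = (if k = l ∧ i = j then 1 else 0) + (if k = j ∧ l = i then 1 else 0) -
      (if k = l ∧ i = j ∧ k = i then 1 else 0) := by
  unfold phaseMoment
  by_cases h1 : k = l <;> by_cases h2 : i = j <;> by_cases h3 : k = i <;> by_cases h4 : l = i <;>
    by_cases h5 : k = j <;> simp_all

theorem sum_phaseMoment (ρ : Op (Fin d)) (i j : Fin d) :
    ∑ k, ∑ l, ρ l k * phaseMoment k l i j =
      (ρ.trace • (1 : Op (Fin d)) + ρ - Matrix.diagonal ρ.diag) i j := by
  simp_rw [phaseMoment_eq, mul_sub, mul_add, Finset.sum_sub_distrib, Finset.sum_add_distrib]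
  simp only [Matrix.sub_apply, Matrix.add_apply, Matrix.smul_apply, Matrix.diagonal_apply,
    Matrix.one_apply, Matrix.trace, Matrix.diag_apply, ite_and, mul_ite, mul_zero, mul_one,
    Finset.sum_ite_eq, Finset.mem_univ, if_true, smul_eq_mul]
  by_cases h : i = j <;> simp [h]

theorem trace_equatorialProj_mul (θ : Fin d → ℝ) (ρ : Op (Fin d)) (i j : Fin d) :
    (equatorialProj θ * ρ).trace * equatorialProj θ i j =
      ∑ k, ∑ l, ρ l k * (equatorialProj θ k l * equatorialProj θ i j) := by
  simp only [Matrix.trace, Matrix.diag_apply, Matrix.mul_apply, Finset.sum_mul]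
  refine Finset.sum_congr rfl fun k _ => Finset.sum_congr rfl fun l _ => ?_
  ring

theorem channelZero_eq (ρ : Op (Fin d)) :
    channelZero d ρ =
      (d : ℂ)⁻¹ • (ρ.trace • (1 : Op (Fin d)) + ρ - Matrix.diagonal ρ.diag) := by
  ext i j
  have hd : (d : ℂ) * (d : ℂ)⁻¹ ^ 2 = (d : ℂ)⁻¹ := by
    -- For `d = 0` both sides vanish because `0⁻¹ = 0`.
    rcases eq_or_ne (d : ℂ) 0 with h | h
    · simp [h]
    · field_simp
  have h : ⨍ θ in angleCube d, (equatorialProj θ * ρ).trace * equatorialProj θ i j =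
      ∑ k, ∑ l, ρ l k * ((d : ℂ)⁻¹ ^ 2 * phaseMoment k l i j) := by
    simp_rw [trace_equatorialProj_mul, ← average_equatorialProj_mul, setAverage_eq]
    rw [integral_finsetSum _ fun k _ => integrable_finsetSum _ fun l _ =>
      (integrableOn_equatorialProj_mul k l i j).const_mul _, Finset.smul_sum]
    refine Finset.sum_congr rfl fun k _ => ?_
    rw [integral_finsetSum _ fun l _ =>
      (integrableOn_equatorialProj_mul k l i j).const_mul _, Finset.smul_sum]
    refine Finset.sum_congr rfl fun l _ => ?_
    rw [integral_const_mul, mul_smul_comm]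
  rw [channelZero, Matrix.of_apply, h, Matrix.smul_apply, ← sum_phaseMoment, smul_eq_mul]
  simp_rw [Finset.mul_sum]
  refine Finset.sum_congr rfl fun k _ => Finset.sum_congr rfl fun l _ => ?_
  linear_combination ρ l k * phaseMoment k l i j * hd

/-- The discrete phases have the same fourth moments as the continuous ones, so the integral channel
is exactly a finite average. -/
theorem sum_trace_equatorialProj_smul (ρ : Op (Fin d)) :
    ∑ s : Fin d → Fin 3, (equatorialProj (thirdAngle s) * ρ).trace •
        equatorialProj (thirdAngle s) =
      (3 ^ d / d : ℂ) • channelZero d ρ := by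
  ext i j
  rw [channelZero_eq, Matrix.sum_apply, Matrix.smul_apply, Matrix.smul_apply, ← sum_phaseMoment]
  simp_rw [Matrix.smul_apply, smul_eq_mul, trace_equatorialProj_mul]
  rw [Finset.sum_comm, Finset.mul_sum, Finset.mul_sum]
  refine Finset.sum_congr rfl fun k _ => ?_
  rw [Finset.sum_comm, Finset.mul_sum, Finset.mul_sum]
  refine Finset.sum_congr rfl fun l _ => ?_
  rw [← Finset.mul_sum, sum_equatorialProj_mul]
  ring

theorem star_equatorial_dotProduct (hd : d ≠ 0) (θ : Fin d → ℝ) :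
    star (equatorial θ) ⬝ᵥ equatorial θ = 1 := by
  rw [dotProduct_comm, ← Matrix.trace_vecMulVec]
  change (equatorialProj θ).trace = 1
  have hd' : (d : ℂ) ≠ 0 := by exact_mod_cast hd
  simp only [Matrix.trace, Matrix.diag_apply, equatorialProj_apply, ← Complex.exp_add,
    add_neg_cancel, Complex.exp_zero]
  simp [hd']

theorem isRankOneProj_equatorialProj (hd : d ≠ 0) (θ : Fin d → ℝ) :
    IsRankOneProj (equatorialProj θ) :=
  isRankOneProj_vecMulVec (star_equatorial_dotProduct hd θ)

theorem channelZero_one (hd : d ≠ 0) : channelZero d 1 = 1 := by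
  have hd' : (d : ℂ) ≠ 0 := by exact_mod_cast hd
  have : Matrix.diagonal (1 : Op (Fin d)).diag = 1 := by
    ext i j
    simp [Matrix.diagonal_apply, Matrix.one_apply]
  rw [channelZero_eq, this, add_sub_cancel_right, smul_smul, Matrix.trace_one, Fintype.card_fin,
    inv_mul_cancel₀ hd', one_smul]

theorem sum_equatorialProj (hd : d ≠ 0) :
    ∑ s : Fin d → Fin 3, equatorialProj (thirdAngle s) =
      (3 ^ d / d : ℂ) • (1 : Op (Fin d)) := by
  have h := sum_trace_equatorialProj_smul (1 : Op (Fin d))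
  simp_rw [Matrix.mul_one, (isRankOneProj_equatorialProj hd _).trace_eq_one, one_smul,
    channelZero_one hd] at h
  exact h

/-- A finite POVM is required, so the continuum of angles is replaced by the `3 ^ d` phase strings.
-/
theorem isMeasurePrepare_channelZero (hd : d ≠ 0) : IsMeasurePrepare (channelZero d) := by
  have hd' : (d : ℂ) ≠ 0 := by exact_mod_cast hd
  have hc : (d / 3 ^ d : ℂ) * (3 ^ d / d) = 1 := by field_simp
  refine .of_fintype (ι := Fin d → Fin 3)
    (fun s => (d / 3 ^ d : ℂ) • equatorialProj (thirdAngle s))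
    (fun s => equatorialProj (thirdAngle s))
    (fun s => (isRankOneProj_equatorialProj hd _).posSemidef.smul ?_) ?_
    (fun s => (isRankOneProj_equatorialProj hd _).isDensity) fun ρ => ?_
  · have : (0 : ℝ) ≤ d / 3 ^ d := by positivity
    simpa using Complex.zero_le_real.mpr this
  · rw [← Finset.smul_sum, sum_equatorialProj hd, smul_smul, hc, one_smul]
  · simp_rw [Matrix.smul_mul, Matrix.trace_smul, smul_assoc]
    rw [← Finset.smul_sum, sum_trace_equatorialProj_smul, smul_smul, hc, one_smul]

end Phases

/-! ### The classical channel of the cut -/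

section ChannelOne

theorem isRankOneProj_single {n : Type*} [Fintype n] [DecidableEq n] (k : n) :
    IsRankOneProj (Matrix.single k k (1 : ℂ)) := by
  have h : Matrix.single k k (1 : ℂ) =
      Matrix.vecMulVec (Pi.single k 1) (star (Pi.single k 1)) := by
    rw [Matrix.single_eq_single_vecMulVec_single]
    congr 1
    ext j
    by_cases h : j = k <;> simp [h]
  rw [h]
  exact isRankOneProj_vecMulVec (by simp)

variable {d : ℕ}

theorem trace_single_mul_self (k : Fin d) (ρ : Op (Fin d)) :
    (Matrix.single k k (1 : ℂ) * ρ).trace = ρ k k := by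
  simp [Matrix.trace_single_mul]

theorem channelOne_eq (ρ : Op (Fin d)) :
    channelOne d ρ =
      ((d : ℂ) - 1)⁻¹ • (ρ.trace • (1 : Op (Fin d)) - Matrix.diagonal ρ.diag) := by
  have h := fun k => trace_single_mul_self k ρ
  unfold channelOne
  congr 1
  simp_rw [h]
  have hp : ∑ kl ∈ (Finset.univ : Finset (Fin d)) ×ˢ Finset.univ,
      ρ kl.1 kl.1 • Matrix.single kl.2 kl.2 (1 : ℂ) = ρ.trace • (1 : Op (Fin d)) := by
    rw [Finset.sum_product, ← Matrix.sum_single_one, Matrix.trace, Finset.sum_smul]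
    simp_rw [Finset.smul_sum]
    rfl
  have hdg : ∑ kl ∈ (Finset.univ : Finset (Fin d)).diag,
      ρ kl.1 kl.1 • Matrix.single kl.2 kl.2 (1 : ℂ) = Matrix.diagonal ρ.diag := by
    rw [Finset.sum_diag, ← Matrix.sum_single_eq_diagonal]
    simp
  rw [← hp, ← hdg, ← Finset.diag_union_offDiag, Finset.sum_union (Finset.disjoint_diag_offDiag _)]
  abel

/-- Grouping the pairs by `k`: measure in the standard basis, then prepare the uniform mixture of
the other basis states. -/
theorem isMeasurePrepare_channelOne (hd : 2 ≤ d) : IsMeasurePrepare (channelOne d) := by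
  have hd1 : (0 : ℝ) < (d : ℝ) - 1 := by
    have : (2 : ℝ) ≤ d := by exact_mod_cast hd
    linarith
  have hdc : ((d : ℂ) - 1) ≠ 0 := by exact_mod_cast hd1.ne'
  have hD : ∀ k : Fin d, IsDensity (Matrix.single k k (1 : ℂ)) := fun k =>
    (isRankOneProj_single k).isDensity
  refine .of_fintype (ι := Fin d) (fun k => Matrix.single k k 1)
    (fun k => ((d : ℂ) - 1)⁻¹ • (1 - Matrix.single k k 1)) (fun k => (hD k).1)
    Matrix.sum_single_one (fun k => ⟨(hD k).one_sub_posSemidef.smul ?_, ?_⟩) fun ρ => ?_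
  · have := Complex.zero_le_real.mpr (inv_nonneg.mpr hd1.le)
    simpa using this
  · rw [Matrix.trace_smul, Matrix.trace_sub, Matrix.trace_one, Fintype.card_fin, (hD k).2,
      smul_eq_mul, inv_mul_cancel₀ hdc]
  · have hdg : Matrix.diagonal ρ.diag = ∑ k, ρ k k • Matrix.single k k (1 : ℂ) := by
      rw [← Matrix.sum_single_eq_diagonal]
      simp
    simp_rw [trace_single_mul_self, smul_comm (ρ _ _)]
    rw [channelOne_eq, ← Finset.smul_sum, hdg, Matrix.trace, Finset.sum_smul,
      ← Finset.sum_sub_distrib]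
    simp_rw [smul_sub]
    rfl

end ChannelOne

/-! ### Law of the data and the indistinguishability bound -/

section RoundLaw

/-- Product measures of finitely many factors are monotone in the factors. -/
theorem measure_pi_mono {ι : Type*} [Fintype ι] {α : ι → Type*} [∀ i, MeasurableSpace (α i)]
    {μ ν : ∀ i, Measure (α i)} (h : ∀ i, μ i ≤ ν i) : Measure.pi μ ≤ Measure.pi ν := by
  refine Measure.le_iff.mpr fun s hs => ?_
  rw [Measure.pi, Measure.pi, toMeasure_apply _ _ hs, toMeasure_apply _ _ hs]
  refine OuterMeasure.le_boundedBy.mpr (fun t => ?_) s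
  refine (OuterMeasure.boundedBy_le t).trans ?_
  exact Finset.prod_le_prod' fun i _ => h i _

theorem bind_mono_left {α β : Type*} [MeasurableSpace α] [MeasurableSpace β] {μ ν : Measure α}
    (h : μ ≤ ν) (κ : Kernel α β) : μ.bind κ ≤ ν.bind κ := by
  refine Measure.le_iff.mpr fun s hs => ?_
  rw [Measure.bind_apply hs κ.aemeasurable, Measure.bind_apply hs κ.aemeasurable]
  exact lintegral_mono' h le_rfl

variable {Z a e : Type*} [MeasurableSpace Z] [Fintype a] [DecidableEq a] [Fintype e]
  {p : Measure Z} {M : Z → Op a → Op a} {X : Op (a × e)} {ρ : Op (a × e)}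

/-- The probability of the outcome `1` when measuring the projection `X` after applying
`Φ ⊗ id`. -/
def hitProb (X : Op (a × e)) (Φ : Op a → Op a) (ρ : Op (a × e)) : ℝ :=
  (X * tensorId Φ ρ).trace.re

theorem IsMPEnsemble.measurable_hitProb (hM : IsMPEnsemble p M) (X ρ : Op (a × e)) :
    Measurable fun z => hitProb X (M z) ρ := by
  simp only [hitProb, Matrix.trace, Matrix.diag_apply, Matrix.mul_apply]
  refine Complex.measurable_re.comp (Finset.measurable_sum _ fun x _ =>
    Finset.measurable_sum _ fun y _ => Measurable.const_mul ?_ _)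
  exact hM.measurable _ _ _

variable [DecidableEq e]

theorem hitProb_nonneg (hX : IsRankOneProj X) {Φ : Op a → Op a} (hΦ : IsMeasurePrepare Φ)
    (hρ : IsDensity ρ) : 0 ≤ hitProb X Φ ρ :=
  (Complex.le_def.mp (trace_mul_nonneg hX.posSemidef (hΦ.tensorId_isDensity hρ).1)).1

theorem hitProb_le_one (hX : IsRankOneProj X) {Φ : Op a → Op a} (hΦ : IsMeasurePrepare Φ)
    (hρ : IsDensity ρ) : hitProb X Φ ρ ≤ 1 :=
  (trace_mul_le hX.posSemidef (hΦ.tensorId_isDensity hρ)).trans_eq hX.isDensity.trace_re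

theorem measurable_smul_dirac {g : Z → ℝ} (hg : Measurable g) (x : ℝ) :
    Measurable fun z => ENNReal.ofReal (g z) • Measure.dirac (z, x) := by
  refine Measure.measurable_of_measurable_coe _ fun s hs => ?_
  simp only [Measure.smul_apply, smul_eq_mul]
  exact hg.ennreal_ofReal.mul ((Measure.measurable_coe hs).comp
    (Measure.measurable_dirac.comp measurable_prodMk_right))

theorem roundLaw_eq (hM : IsMPEnsemble p M) (hX : IsRankOneProj X) (hρ : IsDensity ρ) :
    roundLaw p M hX.isHermitian ρ = p.bind fun z =>
      ENNReal.ofReal (1 - hitProb X (M z) ρ) • Measure.dirac (z, (0 : ℝ)) +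
        ENNReal.ofReal (hitProb X (M z) ρ) • Measure.dirac (z, (1 : ℝ)) := by
  unfold roundLaw
  congr 1
  ext1 z
  have hm : Measurable fun x : ℝ => (z, x) := measurable_prodMk_left
  rw [outcomeLaw_eq hX.isHermitian hX.idem ((hM.isMeasurePrepare z).tensorId_isDensity hρ),
    Measure.map_add _ _ hm, Measure.map_smul, Measure.map_smul, Measure.map_dirac' hm,
    Measure.map_dirac' hm]
  rfl

theorem roundLaw_apply (hM : IsMPEnsemble p M) (hX : IsRankOneProj X) (hρ : IsDensity ρ)
    {s : Set (Z × ℝ)} (hs : MeasurableSet s) :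
    roundLaw p M hX.isHermitian ρ s = ∫⁻ z,
      (ENNReal.ofReal (1 - hitProb X (M z) ρ) • Measure.dirac (z, (0 : ℝ)) +
        ENNReal.ofReal (hitProb X (M z) ρ) • Measure.dirac (z, (1 : ℝ)) : Measure (Z × ℝ)) s
        ∂p := by
  have hq := hM.measurable_hitProb X ρ
  rw [roundLaw_eq hM hX hρ, Measure.bind_apply hs (Measurable.aemeasurable ?_)]
  exact (measurable_smul_dirac (hq.const_sub 1) 0).add (measurable_smul_dirac hq 1)

theorem isProbabilityMeasure_roundLaw (hM : IsMPEnsemble p M) (hX : IsRankOneProj X)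
    (hρ : IsDensity ρ) : IsProbabilityMeasure (roundLaw p M hX.isHermitian ρ) := by
  have := hM.isProbabilityMeasure
  refine ⟨?_⟩
  rw [roundLaw_apply hM hX hρ .univ]
  have h : ∀ z, (ENNReal.ofReal (1 - hitProb X (M z) ρ) • Measure.dirac (z, (0 : ℝ)) +
      ENNReal.ofReal (hitProb X (M z) ρ) • Measure.dirac (z, (1 : ℝ)) : Measure (Z × ℝ))
        Set.univ = 1 := fun z => by
    have h0 := hitProb_nonneg hX (hM.isMeasurePrepare z) hρ
    have h1 := hitProb_le_one hX (hM.isMeasurePrepare z) hρ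
    simp [← ENNReal.ofReal_add (sub_nonneg.mpr h1) h0]
  simp [h]

/-- The part of the round law, with outcome `0`, that is common to all states whose probability
of outcome `1` is at most `b`. -/
noncomputable def zeroPart (p : Measure Z) (b : Z → ℝ) : Measure (Z × ℝ) :=
  p.bind fun z => ENNReal.ofReal (1 - b z) • Measure.dirac (z, (0 : ℝ))

theorem zeroPart_le_roundLaw (hM : IsMPEnsemble p M) (hX : IsRankOneProj X) (hρ : IsDensity ρ)
    {b : Z → ℝ} (hb : Measurable b) (hqb : ∀ z, hitProb X (M z) ρ ≤ b z) :
    zeroPart p b ≤ roundLaw p M hX.isHermitian ρ := by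
  refine Measure.le_iff.mpr fun s hs => ?_
  rw [roundLaw_apply hM hX hρ hs, zeroPart, Measure.bind_apply hs
    (measurable_smul_dirac (hb.const_sub 1) 0).aemeasurable]
  refine lintegral_mono fun z => ?_
  rw [Measure.add_apply, Measure.smul_apply, Measure.smul_apply]
  refine le_add_of_le_of_nonneg ?_ zero_le
  simp only [smul_eq_mul]
  gcongr
  exact hqb z

/-- Stated additively because `b`, later a sum of two probabilities, may exceed 1, where
`ENNReal.ofReal (1 - b z)` truncates to 0. -/
theorem one_le_zeroPart_univ [IsProbabilityMeasure p] {b : Z → ℝ} (hb : Measurable b) :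
    1 ≤ zeroPart p b Set.univ + ∫⁻ z, ENNReal.ofReal (b z) ∂p := by
  rw [zeroPart, Measure.bind_apply .univ
    (measurable_smul_dirac (hb.const_sub 1) 0).aemeasurable,
    ← lintegral_add_right _ hb.ennreal_ofReal]
  calc (1 : ENNReal) = ∫⁻ _, 1 ∂p := by simp
    _ ≤ _ := lintegral_mono fun z => by
      have := ENNReal.ofReal_add_le (p := 1 - b z) (q := b z)
      simpa using this

theorem measure_compl_le_ofReal {α : Type*} [MeasurableSpace α] {μ : Measure α}
    [IsProbabilityMeasure μ] {s : Set α} (hs : MeasurableSet s) {δ : ℝ} (hδ0 : 0 ≤ δ)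
    (hδ1 : δ ≤ 1) (h : ENNReal.ofReal (1 - δ) ≤ μ s) : μ sᶜ ≤ ENNReal.ofReal δ := by
  rw [prob_compl_eq_one_sub hs]
  refine tsub_le_iff_right.mpr ?_
  calc (1 : ENNReal) = ENNReal.ofReal δ + ENNReal.ofReal (1 - δ) := by
        rw [← ENNReal.ofReal_add hδ0 (sub_nonneg.mpr hδ1)]
        simp
    _ ≤ _ := by gcongr

theorem measurableSet_estimate (t ε : ℝ) : MeasurableSet {μ : ℝ | |μ - t| ≤ ε} :=
  (isClosed_le (by fun_prop) continuous_const).measurableSet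

/-- A procedure that succeeds must distinguish states whose expectation values differ by one, so
the part of the data law common to both states has small mass. -/
theorem Succeeds.pow_le (hM : IsMPEnsemble p M) (hX : IsRankOneProj X) {ρ' : Op (a × e)}
    (hρ : IsDensity ρ) (hρ' : IsDensity ρ') (hdiff : (X * ρ).trace.re - (X * ρ').trace.re = 1)
    {ε δ : ℝ} (hε : ε < 1 / 2) (hδ0 : 0 ≤ δ) (hδ1 : δ ≤ 1) {N : ℕ}
    {post : Kernel (Fin N → Z × ℝ) ℝ} [IsMarkovKernel post]
    (hS : Succeeds p M hX.isHermitian N post ε δ) {S : Measure (Z × ℝ)}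
    (hSρ : S ≤ roundLaw p M hX.isHermitian ρ) (hSρ' : S ≤ roundLaw p M hX.isHermitian ρ') :
    S Set.univ ^ N ≤ ENNReal.ofReal (2 * δ) := by
  have hP := isProbabilityMeasure_roundLaw hM hX hρ
  have hP' := isProbabilityMeasure_roundLaw hM hX hρ'
  have hfin : IsFiniteMeasure S := isFiniteMeasure_of_le _ hSρ
  have key : ∀ ρ₀, IsDensity ρ₀ → S ≤ roundLaw p M hX.isHermitian ρ₀ →
      ((Measure.pi fun _ : Fin N => S).bind post) {μ | |μ - (X * ρ₀).trace.re| ≤ ε}ᶜ ≤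
        ENNReal.ofReal δ := fun ρ₀ hρ₀ hle => by
    have := isProbabilityMeasure_roundLaw hM hX hρ₀
    have hE : IsProbabilityMeasure (estimateLaw p M hX.isHermitian N post ρ₀) := by
      unfold estimateLaw
      infer_instance
    -- Domination of one round passes to the product law and through the post-processing.
    refine (bind_mono_left (measure_pi_mono fun _ => hle) post _).trans ?_
    exact measure_compl_le_ofReal (measurableSet_estimate _ _) hδ0 hδ1 (hS ρ₀ hρ₀)
  -- The two acceptance intervals have centres at distance 1 and radius below `1 / 2`, so no
  -- estimate is acceptable for both states.
  have hcover : (Set.univ : Set ℝ) ⊆ {μ | |μ - (X * ρ).trace.re| ≤ ε}ᶜ ∪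
      {μ | |μ - (X * ρ').trace.re| ≤ ε}ᶜ := fun μ _ => by
    by_contra hc
    simp only [Set.mem_union, Set.mem_compl_iff, Set.mem_ofPred_eq, not_or, not_not] at hc
    have h1 := abs_le.mp hc.1
    have h2 := abs_le.mp hc.2
    linarith
  calc S Set.univ ^ N = ((Measure.pi fun _ : Fin N => S).bind post) Set.univ := by
        rw [Measure.bind_apply .univ post.aemeasurable]
        simp [Measure.pi_univ]
    _ ≤ _ := (measure_mono hcover).trans (measure_union_le _ _)
    _ ≤ ENNReal.ofReal δ + ENNReal.ofReal δ := add_le_add (key ρ hρ hSρ) (key ρ' hρ' hSρ')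
    _ = ENNReal.ofReal (2 * δ) := by rw [← ENNReal.ofReal_add hδ0 hδ0, two_mul]

/-- Taking `b` as the sum of the two hit probabilities puts `zeroPart p b` below both round laws.
Its mass `s` satisfies `1 - r ≤ s` and `s ^ N ≤ 2 δ`, and Bernoulli's inequality concludes. -/
theorem Succeeds.le_mul_card (hM : IsMPEnsemble p M) (hX : IsRankOneProj X) {ρ' : Op (a × e)}
    (hρ : IsDensity ρ) (hρ' : IsDensity ρ') (hdiff : (X * ρ).trace.re - (X * ρ').trace.re = 1)
    {ε δ : ℝ} (hε : ε < 1 / 2) (hδ0 : 0 ≤ δ) (hδ1 : δ ≤ 1) {N : ℕ}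
    {post : Kernel (Fin N → Z × ℝ) ℝ} [IsMarkovKernel post]
    (hS : Succeeds p M hX.isHermitian N post ε δ) {r : ℝ} (hr : 0 ≤ r)
    (hint : ∫⁻ z, ENNReal.ofReal (hitProb X (M z) ρ + hitProb X (M z) ρ') ∂p ≤
      ENNReal.ofReal r) :
    1 - 2 * δ ≤ N * r := by
  have := hM.isProbabilityMeasure
  set b : Z → ℝ := fun z => hitProb X (M z) ρ + hitProb X (M z) ρ' with hb
  have hbm : Measurable b := (hM.measurable_hitProb X ρ).add (hM.measurable_hitProb X ρ')
  have hle : zeroPart p b ≤ roundLaw p M hX.isHermitian ρ :=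
    zeroPart_le_roundLaw hM hX hρ hbm fun z =>
      le_add_of_nonneg_right (hitProb_nonneg hX (hM.isMeasurePrepare z) hρ')
  have hle' : zeroPart p b ≤ roundLaw p M hX.isHermitian ρ' :=
    zeroPart_le_roundLaw hM hX hρ' hbm fun z =>
      le_add_of_nonneg_left (hitProb_nonneg hX (hM.isMeasurePrepare z) hρ)
  have hpow := hS.pow_le hM hX hρ hρ' hdiff hε hδ0 hδ1 hle hle'
  have hone := (one_le_zeroPart_univ (p := p) hbm).trans (add_le_add_right hint _)
  have hP := isProbabilityMeasure_roundLaw hM hX hρ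
  have hfin : IsFiniteMeasure (zeroPart p b) := isFiniteMeasure_of_le _ hle
  set s : ℝ := (zeroPart p b Set.univ).toReal with hs
  have hs0 : 0 ≤ s := ENNReal.toReal_nonneg
  have hSs : zeroPart p b Set.univ = ENNReal.ofReal s :=
    (ENNReal.ofReal_toReal (measure_ne_top _ _)).symm
  rw [hSs, ← ENNReal.ofReal_pow hs0,
    ENNReal.ofReal_le_ofReal_iff (mul_nonneg zero_le_two hδ0)] at hpow
  rw [hSs, ← ENNReal.ofReal_add hs0 hr, ENNReal.one_le_ofReal] at hone
  have hbern := one_add_mul_le_pow (a := s - 1) (by linarith) N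
  rw [add_sub_cancel] at hbern
  have : (N : ℝ) * (1 - s) ≤ N * r := by
    gcongr
    linarith
  nlinarith

end RoundLaw

/-! ### Lower bound on the number of copies -/

section Necessity

theorem IsRankOneProj.kronecker {m n : Type*} [Fintype m] [DecidableEq m] [Fintype n]
    [DecidableEq n] {P : Op m} {Q : Op n} (hP : IsRankOneProj P) (hQ : IsRankOneProj Q) :
    IsRankOneProj (P ⊗ₖ Q) := by
  have hH : (P ⊗ₖ Q).IsHermitian := (hP.posSemidef.kronecker hQ.posSemidef).isHermitian
  have hI : (P ⊗ₖ Q) * (P ⊗ₖ Q) = P ⊗ₖ Q := by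
    rw [← Matrix.mul_kronecker_mul, hP.idem, hQ.idem]
  have h := trace_eq_rank hH hI
  rw [Matrix.trace_kronecker, hP.trace_eq_one, hQ.trace_eq_one, one_mul] at h
  exact ⟨hH, hI, by exact_mod_cast h.symm⟩

theorem IsDensity.kronecker {m n : Type*} [Fintype m] [Fintype n] {ρ : Op m} {σ : Op n}
    (hρ : IsDensity ρ) (hσ : IsDensity σ) : IsDensity (ρ ⊗ₖ σ) :=
  ⟨hρ.1.kronecker hσ.1, by rw [Matrix.trace_kronecker, hρ.2, hσ.2, one_mul]⟩

section MeasurePrepare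

variable {a : Type*} [Fintype a] [DecidableEq a] {Φ : Op a → Op a}

theorem IsMeasurePrepare.map_smul (hΦ : IsMeasurePrepare Φ) (c : ℂ) (ρ : Op a) :
    Φ (c • ρ) = c • Φ ρ := by
  obtain ⟨m, F, σ, -, -, -, h⟩ := hΦ
  simp_rw [h, Matrix.mul_smul, Matrix.trace_smul, smul_assoc]
  rw [Finset.smul_sum]

theorem IsMeasurePrepare.map_sub (hΦ : IsMeasurePrepare Φ) (ρ ρ' : Op a) :
    Φ (ρ - ρ') = Φ ρ - Φ ρ' := by
  obtain ⟨m, F, σ, -, -, -, h⟩ := hΦ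
  simp_rw [h, Matrix.mul_sub, Matrix.trace_sub, sub_smul]
  rw [Finset.sum_sub_distrib]

theorem IsMeasurePrepare.posSemidef (hΦ : IsMeasurePrepare Φ) {ρ : Op a} (hρ : ρ.PosSemidef) :
    (Φ ρ).PosSemidef := by
  obtain ⟨m, F, σ, hF, -, hσ, h⟩ := hΦ
  rw [h]
  exact Matrix.posSemidef_sum _ fun j _ => (hσ j).1.smul (trace_mul_nonneg (hF j) hρ)

theorem IsMeasurePrepare.trace_eq (hΦ : IsMeasurePrepare Φ) (ρ : Op a) :
    (Φ ρ).trace = ρ.trace := by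
  obtain ⟨m, F, σ, -, hF1, hσ, h⟩ := hΦ
  simp_rw [h, Matrix.trace_sum, Matrix.trace_smul, (hσ _).2, smul_eq_mul, mul_one]
  rw [← Matrix.trace_sum, ← Finset.sum_mul, hF1, Matrix.one_mul]

theorem tensorId_kronecker {e : Type*} (hΦ : IsMeasurePrepare Φ) (α : Op a) (β : Op e) :
    tensorId Φ (α ⊗ₖ β) = Φ α ⊗ₖ β := by
  ext x y
  have h : (Matrix.of fun i j => (α ⊗ₖ β) (i, x.2) (j, y.2)) = β x.2 y.2 • α := by
    ext i j
    simp [mul_comm]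
  rw [tensorId, Matrix.of_apply, h, hΦ.map_smul, Matrix.smul_apply, smul_eq_mul, mul_comm]
  rfl

/-- Using the same pure `Q` in observable and state reduces the problem to `A` alone. -/
theorem hitProb_kronecker {e : Type*} [Fintype e] [DecidableEq e] (hΦ : IsMeasurePrepare Φ)
    (P α : Op a) {Q : Op e} (hQ : IsRankOneProj Q) :
    hitProb (P ⊗ₖ Q) Φ (α ⊗ₖ Q) = (P * Φ α).trace.re := by
  rw [hitProb, tensorId_kronecker hΦ, ← Matrix.mul_kronecker_mul, Matrix.trace_kronecker, hQ.idem,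
    hQ.trace_eq_one, mul_one]

end MeasurePrepare

variable {d : ℕ}

/-- The twirled overlap of an effect with a state. -/
theorem sum_trace_mul_trace_le {F σ : Op (Fin d)} (hF : F.PosSemidef) (hσ : IsDensity σ) :
    (∑ s : Fin d → Fin 3, (F * equatorialProj (thirdAngle s)).trace *
      (equatorialProj (thirdAngle s) * σ).trace).re ≤ 3 ^ d * (2 / d ^ 2) * F.trace.re := by
  have h : ∑ s : Fin d → Fin 3, (F * equatorialProj (thirdAngle s)).trace *
      (equatorialProj (thirdAngle s) * σ).trace =
        ((3 ^ d / d ^ 2 : ℝ) : ℂ) *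
          (F.trace + (F * σ).trace - (F * Matrix.diagonal σ.diag).trace) := by
    calc _ = (F * ∑ s : Fin d → Fin 3, (equatorialProj (thirdAngle s) * σ).trace •
          equatorialProj (thirdAngle s)).trace := by
          rw [Finset.mul_sum, Matrix.trace_sum]
          refine Finset.sum_congr rfl fun s _ => ?_
          rw [Matrix.mul_smul, Matrix.trace_smul, smul_eq_mul, mul_comm]
      _ = _ := by
          rw [sum_trace_equatorialProj_smul, channelZero_eq, hσ.2, one_smul, smul_smul,
            Matrix.mul_smul, Matrix.trace_smul, Matrix.mul_sub, Matrix.mul_add, Matrix.mul_one,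
            Matrix.trace_sub, Matrix.trace_add, smul_eq_mul]
          push_cast
          ring
  have hdiag : 0 ≤ (F * Matrix.diagonal σ.diag).trace.re :=
    (Complex.le_def.mp (trace_mul_nonneg hF
      (Matrix.PosSemidef.diagonal fun _ => hσ.1.diag_nonneg))).1
  rw [h, Complex.re_ofReal_mul, Complex.sub_re, Complex.add_re]
  have hc : (0 : ℝ) ≤ 3 ^ d / d ^ 2 := by positivity
  -- The subtracted diagonal term is nonnegative, and `Tr(Fσ) ≤ Tr F`.
  calc _ ≤ (3 ^ d / d ^ 2 : ℝ) * (2 * F.trace.re) := by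
        gcongr
        linarith [trace_mul_le hF hσ]
    _ = _ := by ring

/-- The measure-and-prepare form is essential: the identity channel would give `3 ^ d`. Each effect
contributes at most `2 Tr(F j) / d²` on average, and the effects have total trace `d`. -/
theorem sum_trace_mul_channel_le (hd : d ≠ 0) {Φ : Op (Fin d) → Op (Fin d)}
    (hΦ : IsMeasurePrepare Φ) :
    ∑ s : Fin d → Fin 3,
      (equatorialProj (thirdAngle s) * Φ (equatorialProj (thirdAngle s))).trace.re ≤
        3 ^ d * (2 / d) := by
  obtain ⟨m, F, σ, hF, hF1, hσ, h⟩ := hΦ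
  have hd' : (d : ℝ) ≠ 0 := by exact_mod_cast hd
  calc _ = ∑ j, (∑ s : Fin d → Fin 3, (F j * equatorialProj (thirdAngle s)).trace *
          (equatorialProj (thirdAngle s) * σ j).trace).re := by
        simp_rw [h, Finset.mul_sum, Matrix.trace_sum, Matrix.mul_smul, Matrix.trace_smul,
          smul_eq_mul, Complex.re_sum]
        exact Finset.sum_comm
    _ ≤ ∑ j, 3 ^ d * (2 / d ^ 2) * (F j).trace.re :=
        Finset.sum_le_sum fun j _ => sum_trace_mul_trace_le (hF j) (hσ j)
    _ = 3 ^ d * (2 / d ^ 2) * d := by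
        rw [← Finset.mul_sum, ← Complex.re_sum, ← Matrix.trace_sum, hF1, Matrix.trace_one]
        simp
    _ = _ := by field_simp

theorem sum_trace_mul_channel_one (hd : d ≠ 0) {Φ : Op (Fin d) → Op (Fin d)}
    (hΦ : IsMeasurePrepare Φ) :
    ∑ s : Fin d → Fin 3, (equatorialProj (thirdAngle s) * Φ 1).trace.re = 3 ^ d := by
  have hd' : (d : ℂ) ≠ 0 := by exact_mod_cast hd
  rw [← Complex.re_sum, ← Matrix.trace_sum, ← Finset.sum_mul, sum_equatorialProj hd,
    Matrix.smul_mul, Matrix.one_mul, Matrix.trace_smul, hΦ.trace_eq, Matrix.trace_one,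
    Fintype.card_fin, smul_eq_mul, div_mul_cancel₀ _ hd']
  exact_mod_cast Complex.ofReal_re (3 ^ d)

/-- The maximally mixed state on the orthogonal complement of a rank-one projection. -/
noncomputable def complState (P : Op (Fin d)) : Op (Fin d) := ((d : ℂ) - 1)⁻¹ • (1 - P)

theorem complState_isDensity (hd : 2 ≤ d) {P : Op (Fin d)} (hP : IsRankOneProj P) :
    IsDensity (complState P) := by
  have hd1 : (0 : ℝ) < (d : ℝ) - 1 := by
    have : (2 : ℝ) ≤ d := by exact_mod_cast hd
    linarith
  have hdc : ((d : ℂ) - 1) ≠ 0 := by exact_mod_cast hd1.ne'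
  refine ⟨hP.isDensity.one_sub_posSemidef.smul ?_, ?_⟩
  · have := Complex.zero_le_real.mpr (inv_nonneg.mpr hd1.le)
    simpa using this
  · rw [complState, Matrix.trace_smul, Matrix.trace_sub, Matrix.trace_one, Fintype.card_fin,
      hP.trace_eq_one, smul_eq_mul, inv_mul_cancel₀ hdc]

/-- Dropping the term `-Tr(P Φ(P)) ≤ 0` leaves the factor `1 / (d - 1)`, at most `2 / d` as `d ≥ 2`.
-/
theorem trace_mul_channel_complState_le (hd : 2 ≤ d) {P : Op (Fin d)} (hP : IsRankOneProj P)
    {Φ : Op (Fin d) → Op (Fin d)} (hΦ : IsMeasurePrepare Φ) :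
    (P * Φ (complState P)).trace.re ≤ 2 / d * (P * Φ 1).trace.re := by
  have hd2 : (2 : ℝ) ≤ d := by exact_mod_cast hd
  have h0 : 0 ≤ (P * Φ P).trace.re :=
    (Complex.le_def.mp (trace_mul_nonneg hP.posSemidef (hΦ.posSemidef hP.posSemidef))).1
  have h1 : 0 ≤ (P * Φ 1).trace.re :=
    (Complex.le_def.mp (trace_mul_nonneg hP.posSemidef (hΦ.posSemidef .one))).1
  have hc : ((d : ℂ) - 1)⁻¹ = ((((d : ℝ) - 1)⁻¹ : ℝ) : ℂ) := by push_cast; rfl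
  have hle : ((d : ℝ) - 1)⁻¹ ≤ 2 / d := by
    rw [inv_eq_one_div, div_le_div_iff₀ (by linarith) (by linarith)]
    linarith
  have hnn : 0 ≤ ((d : ℝ) - 1)⁻¹ := inv_nonneg.mpr (by linarith)
  rw [complState, hΦ.map_smul, hΦ.map_sub, Matrix.mul_smul, Matrix.trace_smul, Matrix.mul_sub,
    Matrix.trace_sub, smul_eq_mul, hc, Complex.re_ofReal_mul, Complex.sub_re]
  calc _ ≤ ((d : ℝ) - 1)⁻¹ * (P * Φ 1).trace.re := by
        gcongr
        linarith
    _ ≤ _ := by gcongr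

theorem sum_hit_le (hd : 2 ≤ d) {Φ : Op (Fin d) → Op (Fin d)} (hΦ : IsMeasurePrepare Φ) :
    ∑ s : Fin d → Fin 3,
      ((equatorialProj (thirdAngle s) * Φ (equatorialProj (thirdAngle s))).trace.re +
        (equatorialProj (thirdAngle s) *
          Φ (complState (equatorialProj (thirdAngle s)))).trace.re) ≤ 3 ^ d * (4 / d) := by
  have hd0 : d ≠ 0 := by omega
  rw [Finset.sum_add_distrib]
  have h1 := sum_trace_mul_channel_le hd0 hΦ
  have h2 := Finset.sum_le_sum fun s (_ : s ∈ (Finset.univ : Finset (Fin d → Fin 3))) =>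
    trace_mul_channel_complState_le hd (isRankOneProj_equatorialProj hd0 (thirdAngle s)) hΦ
  rw [← Finset.mul_sum, sum_trace_mul_channel_one hd0 hΦ] at h2
  calc _ ≤ (3 : ℝ) ^ d * (2 / d) + 2 / d * 3 ^ d := add_le_add h1 h2
    _ = _ := by ring

/-- Every ensemble has an equatorial projection which it rarely detects, both in the projected
state and in its complement. -/
theorem exists_lintegral_hitProb_le {Z : Type*} [MeasurableSpace Z] {p : Measure Z}
    {M : Z → Op (Fin d) → Op (Fin d)} (hd : 2 ≤ d) (hM : IsMPEnsemble p M) {e : Type*}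
    [Fintype e] [DecidableEq e] {Q : Op e} (hQ : IsRankOneProj Q) :
    ∃ P : Op (Fin d), IsRankOneProj P ∧
      ∫⁻ z, ENNReal.ofReal (hitProb (P ⊗ₖ Q) (M z) (P ⊗ₖ Q) +
        hitProb (P ⊗ₖ Q) (M z) (complState P ⊗ₖ Q)) ∂p ≤ ENNReal.ofReal (4 / d) := by
  have hd0 : d ≠ 0 := by omega
  have := hM.isProbabilityMeasure
  have hP := fun s : Fin d → Fin 3 => isRankOneProj_equatorialProj hd0 (thirdAngle s)
  have hz : ∀ z, ∑ s : Fin d → Fin 3, ENNReal.ofReal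
      (hitProb (equatorialProj (thirdAngle s) ⊗ₖ Q) (M z) (equatorialProj (thirdAngle s) ⊗ₖ Q) +
        hitProb (equatorialProj (thirdAngle s) ⊗ₖ Q) (M z)
          (complState (equatorialProj (thirdAngle s)) ⊗ₖ Q)) ≤
        ENNReal.ofReal (3 ^ d * (4 / d)) := fun z => by
    have hΦ := hM.isMeasurePrepare z
    rw [← ENNReal.ofReal_sum_of_nonneg fun s _ => add_nonneg
      (hitProb_nonneg ((hP s).kronecker hQ) hΦ ((hP s).kronecker hQ).isDensity)
      (hitProb_nonneg ((hP s).kronecker hQ) hΦ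
        ((complState_isDensity hd (hP s)).kronecker hQ.isDensity))]
    simp_rw [hitProb_kronecker hΦ _ _ hQ]
    exact ENNReal.ofReal_le_ofReal (sum_hit_le hd hΦ)
  have hsum : ∑ s : Fin d → Fin 3, ∫⁻ z, ENNReal.ofReal
      (hitProb (equatorialProj (thirdAngle s) ⊗ₖ Q) (M z) (equatorialProj (thirdAngle s) ⊗ₖ Q) +
        hitProb (equatorialProj (thirdAngle s) ⊗ₖ Q) (M z)
          (complState (equatorialProj (thirdAngle s)) ⊗ₖ Q)) ∂p ≤
      ∑ _s : Fin d → Fin 3, ENNReal.ofReal (4 / d) := by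
    have hm : ∀ X ρ ρ', Measurable fun z =>
        ENNReal.ofReal (hitProb (e := e) X (M z) ρ + hitProb X (M z) ρ') := fun X ρ ρ' =>
      ((hM.measurable_hitProb X ρ).add (hM.measurable_hitProb X ρ')).ennreal_ofReal
    rw [← lintegral_finsetSum _ fun s _ => hm _ _ _]
    calc _ ≤ ∫⁻ _, ENNReal.ofReal (3 ^ d * (4 / d)) ∂p := lintegral_mono hz
      _ = ENNReal.ofReal (3 ^ d * (4 / d)) := by simp
      _ = _ := by
        rw [Finset.sum_const, nsmul_eq_mul, ENNReal.ofReal_mul (by positivity)]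
        simp
  -- Pigeonhole after integrating over labels: one phase string must work for the whole ensemble.
  obtain ⟨s, -, hs⟩ := ENNReal.exists_le_of_sum_le Finset.univ_nonempty hsum
  exact ⟨_, hP s, hs⟩

/-- The witness `X` is fixed by the ensemble before `ε`, `N` and the post-processing are chosen. -/
theorem necessity {Z : Type*} [MeasurableSpace Z] {p : Measure Z}
    {M : Z → Op (Fin d) → Op (Fin d)} (hd : 2 ≤ d) (hM : IsMPEnsemble p M) {e : Type*}
    [Fintype e] [DecidableEq e] [Nonempty e] {δ : ℝ} (hδ0 : 0 ≤ δ) (hδ1 : δ ≤ 1) :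
    ∃ (X : Op (Fin d × e)) (hX : IsRankOneProj X), ∀ ε : ℝ, ε < 1 / 2 →
      ∀ (N : ℕ) (post : Kernel (Fin N → Z × ℝ) ℝ) [IsMarkovKernel post],
        Succeeds p M hX.isHermitian N post ε δ → (1 - 2 * δ) / 4 * d ≤ N := by
  have hQ := isRankOneProj_single (Classical.arbitrary e)
  obtain ⟨P, hP, hint⟩ := exists_lintegral_hitProb_le hd hM hQ
  have hX := hP.kronecker hQ
  refine ⟨_, hX, fun ε hε N post _ hS => ?_⟩
  have hd0 : (0 : ℝ) < d := by
    have : 0 < d := by omega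
    exact_mod_cast this
  have hdiff : ((P ⊗ₖ Matrix.single (Classical.arbitrary e) (Classical.arbitrary e) (1 : ℂ)) *
      (P ⊗ₖ Matrix.single (Classical.arbitrary e) (Classical.arbitrary e) (1 : ℂ))).trace.re -
      ((P ⊗ₖ Matrix.single (Classical.arbitrary e) (Classical.arbitrary e) (1 : ℂ)) *
      (complState P ⊗ₖ
        Matrix.single (Classical.arbitrary e) (Classical.arbitrary e) (1 : ℂ))).trace.re = 1 := by
    rw [hX.idem, hX.trace_eq_one, ← Matrix.mul_kronecker_mul, complState, Matrix.mul_smul,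
      Matrix.mul_sub, Matrix.mul_one, hP.idem, sub_self]
    simp
  have h := hS.le_mul_card hM hX hX.isDensity
    ((complState_isDensity hd hP).kronecker hQ.isDensity) hdiff hε hδ0 hδ1 (by positivity) hint
  rw [← mul_div_assoc, le_div_iff₀ hd0] at h
  linarith

end Necessity

/-! ### Unbiasedness, variance and Chebyshev for the optimal cut -/

section Sufficiency

variable {d : ℕ} {e : Type*}

theorem tensorId_smul {a : Type*} (c : ℂ) (Φ : Op a → Op a) (ρ : Op (a × e)) :
    tensorId (fun τ => c • Φ τ) ρ = c • tensorId Φ ρ := rfl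

/-- Completely depolarizing map, without normalization. -/
def traceOne (τ : Op (Fin d)) : Op (Fin d) := τ.trace • (1 : Op (Fin d))

/-- Complete dephasing. -/
def dephase (τ : Op (Fin d)) : Op (Fin d) := Matrix.diagonal τ.diag

theorem tensorId_traceOne (ρ : Op (Fin d × e)) :
    tensorId traceOne ρ = (1 : Op (Fin d)) ⊗ₖ condBlock 1 ρ := by
  have h : ∀ τ : Op (Fin d), traceOne τ = ∑ _j : Unit, ((1 : Op (Fin d)) * τ).trace • 1 := by
    simp [traceOne]
  rw [tensorId_eq_sum h]
  simp

theorem tensorId_dephase_posSemidef [Fintype e] {ρ : Op (Fin d × e)} (hρ : ρ.PosSemidef) :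
    (tensorId dephase ρ).PosSemidef := by
  have h : ∀ τ : Op (Fin d), dephase τ =
      ∑ k, (Matrix.single k k (1 : ℂ) * τ).trace • Matrix.single k k (1 : ℂ) := fun τ => by
    simp_rw [trace_single_mul_self]
    rw [dephase, ← Matrix.sum_single_eq_diagonal]
    simp
  rw [tensorId_eq_sum h]
  have hk := fun k : Fin d => (isRankOneProj_single k).posSemidef
  exact Matrix.posSemidef_sum _ fun k _ => (hk k).kronecker (condBlock_posSemidef (hk k) hρ)

theorem smul_tensorId_channelZero (hd : d ≠ 0) (ρ : Op (Fin d × e)) :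
    (d : ℂ) • tensorId (channelZero d) ρ =
      tensorId traceOne ρ + ρ - tensorId dephase ρ := by
  have hd' : (d : ℂ) ≠ 0 := by exact_mod_cast hd
  have h : channelZero d = fun τ => (d : ℂ)⁻¹ • (traceOne τ + τ - dephase τ) := by
    funext τ
    exact channelZero_eq τ
  rw [h, tensorId_smul, smul_smul, mul_inv_cancel₀ hd', one_smul]
  rfl

theorem smul_tensorId_channelOne (hd : 2 ≤ d) (ρ : Op (Fin d × e)) :
    ((d : ℂ) - 1) • tensorId (channelOne d) ρ = tensorId traceOne ρ - tensorId dephase ρ := by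
  have hd' : (d : ℂ) - 1 ≠ 0 := by
    rw [sub_ne_zero]
    exact_mod_cast (show d ≠ 1 by omega)
  have h : channelOne d = fun τ => ((d : ℂ) - 1)⁻¹ • (traceOne τ - dephase τ) := by
    funext τ
    exact channelOne_eq τ
  rw [h, tensorId_smul, smul_smul, mul_inv_cancel₀ hd', one_smul]
  rfl

variable [Fintype e]

/-- The depolarizing and dephasing parts of the two rescaled channels cancel, leaving the identity
map. -/
theorem hitProb_channel_diff (hd : 2 ≤ d) (X ρ : Op (Fin d × e)) :
    d * hitProb X (channelZero d) ρ - (d - 1) * hitProb X (channelOne d) ρ =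
      (X * ρ).trace.re := by
  have h : (d : ℂ) • tensorId (channelZero d) ρ - ((d : ℂ) - 1) • tensorId (channelOne d) ρ =
      ρ := by
    rw [smul_tensorId_channelZero (by omega), smul_tensorId_channelOne hd]
    abel
  conv_rhs => rw [← h]
  rw [Matrix.mul_sub, Matrix.mul_smul, Matrix.mul_smul, Matrix.trace_sub, Matrix.trace_smul,
    Matrix.trace_smul, Complex.sub_re, smul_eq_mul, smul_eq_mul, hitProb, hitProb]
  have h1 : ((d : ℂ) - 1) = (((d : ℝ) - 1 : ℝ) : ℂ) := by push_cast; rfl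
  rw [h1, ← Complex.ofReal_natCast, Complex.re_ofReal_mul, Complex.re_ofReal_mul]

variable [DecidableEq e]

/-- The dephasing part only subtracts, and `1 ⊗ ρ_E ≤ 1` bounds the rest by `Tr X = 1`. Here rank
one keeps the bound free of both dimensions. -/
theorem hitProb_channelOne_le (hd : 2 ≤ d) {X ρ : Op (Fin d × e)} (hX : IsRankOneProj X)
    (hρ : IsDensity ρ) : ((d : ℝ) - 1) * hitProb X (channelOne d) ρ ≤ 1 := by
  have h1 : ((d : ℂ) - 1) = (((d : ℝ) - 1 : ℝ) : ℂ) := by push_cast; rfl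
  have hE := condBlock_one_isDensity hρ
  have hle : (X * ((1 : Op (Fin d)) ⊗ₖ condBlock 1 ρ)).trace.re ≤ 1 := by
    have h := trace_mul_nonneg hX.posSemidef
      (Matrix.PosSemidef.one (n := Fin d) (R := ℂ) |>.kronecker hE.one_sub_posSemidef)
    have hs : (1 : Op (Fin d)) ⊗ₖ (1 - condBlock 1 ρ) =
        1 - (1 : Op (Fin d)) ⊗ₖ condBlock 1 ρ := by
      rw [← Matrix.one_kronecker_one]
      ext x y
      simp only [Matrix.sub_apply, Matrix.kroneckerMap_apply, mul_sub]
    rw [hs, Matrix.mul_sub, Matrix.mul_one, Matrix.trace_sub, hX.trace_eq_one] at h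
    have := (Complex.le_def.mp h).1
    simp only [Complex.zero_re, Complex.sub_re, Complex.one_re] at this
    linarith
  have hdeph := (Complex.le_def.mp
    (trace_mul_nonneg hX.posSemidef (tensorId_dephase_posSemidef hρ.1))).1
  rw [hitProb, ← Complex.re_ofReal_mul, ← h1, ← smul_eq_mul, ← Matrix.trace_smul,
    ← Matrix.mul_smul, smul_tensorId_channelOne hd, tensorId_traceOne, Matrix.mul_sub,
    Matrix.trace_sub, Complex.sub_re]
  simp only [Complex.zero_re] at hdeph
  linarith

theorem isMPEnsemble_cut (hd : 2 ≤ d) : IsMPEnsemble (cutDist d) (cutChannel d) where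
  isProbabilityMeasure := by
    have hd2 : (2 : ℝ) ≤ d := by exact_mod_cast hd
    refine ⟨?_⟩
    have h1 : (0 : ℝ) ≤ d / (2 * d - 1) := div_nonneg (by linarith) (by linarith)
    have h2 : (0 : ℝ) ≤ (d - 1) / (2 * d - 1) := div_nonneg (by linarith) (by linarith)
    have h3 : (2 * d - 1 : ℝ) ≠ 0 := by linarith
    have h4 : (d / (2 * d - 1) + (d - 1) / (2 * d - 1) : ℝ) = 1 := by
      rw [← add_div, div_eq_one_iff_eq h3]
      ring
    simp [cutDist, ← ENNReal.ofReal_add h1 h2, h4]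
  isMeasurePrepare z := by
    fin_cases z
    · exact isMeasurePrepare_channelZero (by omega)
    · exact isMeasurePrepare_channelOne hd
  measurable _ _ _ := measurable_of_countable _

/-- Law of one round of the optimal cut. -/
theorem roundLaw_cut (hd : 2 ≤ d) {X ρ : Op (Fin d × e)} (hX : IsRankOneProj X)
    (hρ : IsDensity ρ) :
    roundLaw (cutDist d) (cutChannel d) hX.isHermitian ρ =
      ENNReal.ofReal ((d : ℝ) / (2 * d - 1)) •
        (ENNReal.ofReal (1 - hitProb X (channelZero d) ρ) • Measure.dirac (0, (0 : ℝ)) +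
          ENNReal.ofReal (hitProb X (channelZero d) ρ) • Measure.dirac (0, (1 : ℝ))) +
      ENNReal.ofReal (((d : ℝ) - 1) / (2 * d - 1)) •
        (ENNReal.ofReal (1 - hitProb X (channelOne d) ρ) • Measure.dirac (1, (0 : ℝ)) +
          ENNReal.ofReal (hitProb X (channelOne d) ρ) • Measure.dirac (1, (1 : ℝ))) := by
  ext s hs
  rw [roundLaw_apply (isMPEnsemble_cut hd) hX hρ hs, cutDist, lintegral_add_measure,
    lintegral_smul_measure, lintegral_smul_measure, lintegral_dirac, lintegral_dirac]
  rfl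

/-- The law is a finite combination of Dirac masses, so every function is integrable. -/
theorem integrable_roundLaw_cut (hd : 2 ≤ d) {X ρ : Op (Fin d × e)} (hX : IsRankOneProj X)
    (hρ : IsDensity ρ) (g : Fin 2 × ℝ → ℝ) :
    Integrable g (roundLaw (cutDist d) (cutChannel d) hX.isHermitian ρ) := by
  have hdir : ∀ (c : ℝ) (y : Fin 2 × ℝ),
      Integrable g (ENNReal.ofReal c • Measure.dirac y) := fun c y =>
    (integrable_dirac (by simp)).smul_measure ENNReal.ofReal_ne_top
  rw [roundLaw_cut hd hX hρ]
  exact (((hdir _ _).add_measure (hdir _ _)).smul_measure ENNReal.ofReal_ne_top).add_measure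
    (((hdir _ _).add_measure (hdir _ _)).smul_measure ENNReal.ofReal_ne_top)

theorem integral_roundLaw_cut (hd : 2 ≤ d) {X ρ : Op (Fin d × e)} (hX : IsRankOneProj X)
    (hρ : IsDensity ρ) (g : Fin 2 × ℝ → ℝ) :
    ∫ y, g y ∂(roundLaw (cutDist d) (cutChannel d) hX.isHermitian ρ) =
      (d : ℝ) / (2 * d - 1) * ((1 - hitProb X (channelZero d) ρ) * g (0, 0) +
        hitProb X (channelZero d) ρ * g (0, 1)) +
      ((d : ℝ) - 1) / (2 * d - 1) * ((1 - hitProb X (channelOne d) ρ) * g (1, 0) +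
        hitProb X (channelOne d) ρ * g (1, 1)) := by
  have hd2 : (2 : ℝ) ≤ d := by exact_mod_cast hd
  have hdir : ∀ (c : ℝ) (y : Fin 2 × ℝ),
      Integrable g (ENNReal.ofReal c • Measure.dirac y) := fun c y =>
    (integrable_dirac (by simp)).smul_measure ENNReal.ofReal_ne_top
  have hint : ∀ (c : ℝ) (y : Fin 2 × ℝ), 0 ≤ c →
      ∫ x, g x ∂(ENNReal.ofReal c • Measure.dirac y) = c * g y := fun c y hc => by
    rw [integral_smul_measure, integral_dirac, ENNReal.toReal_ofReal hc, smul_eq_mul]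
  have hM0 : IsMeasurePrepare (channelZero d) :=
    (isMPEnsemble_cut hd).isMeasurePrepare 0
  have hM1 : IsMeasurePrepare (channelOne d) :=
    (isMPEnsemble_cut hd).isMeasurePrepare 1
  rw [roundLaw_cut hd hX hρ, integral_add_measure
    (((hdir _ _).add_measure (hdir _ _)).smul_measure ENNReal.ofReal_ne_top)
    (((hdir _ _).add_measure (hdir _ _)).smul_measure ENNReal.ofReal_ne_top),
    integral_smul_measure, integral_smul_measure, integral_add_measure (hdir _ _) (hdir _ _),
    integral_add_measure (hdir _ _) (hdir _ _),
    hint _ _ (sub_nonneg.mpr (hitProb_le_one hX hM0 hρ)), hint _ _ (hitProb_nonneg hX hM0 hρ),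
    hint _ _ (sub_nonneg.mpr (hitProb_le_one hX hM1 hρ)), hint _ _ (hitProb_nonneg hX hM1 hρ),
    ENNReal.toReal_ofReal (div_nonneg (by linarith) (by linarith)),
    ENNReal.toReal_ofReal (div_nonneg (by linarith) (by linarith))]
  rfl

/-- The contribution of one round to the empirical mean. -/
def roundEstimate (d : ℕ) (y : Fin 2 × ℝ) : ℝ := (2 * (d : ℝ) - 1) * (-1) ^ (y.1 : ℕ) * y.2

theorem measurable_roundEstimate (d : ℕ) : Measurable (roundEstimate d) := by
  have h1 : Measurable fun y : Fin 2 × ℝ => ((-1 : ℝ) ^ (y.1 : ℕ)) :=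
    (measurable_of_countable fun z : Fin 2 => (-1 : ℝ) ^ (z : ℕ)).comp measurable_fst
  exact (h1.const_mul _).mul measurable_snd

theorem integral_roundEstimate (hd : 2 ≤ d) {X ρ : Op (Fin d × e)} (hX : IsRankOneProj X)
    (hρ : IsDensity ρ) :
    ∫ y, roundEstimate d y ∂(roundLaw (cutDist d) (cutChannel d) hX.isHermitian ρ) =
      (X * ρ).trace.re := by
  have hd2 : (2 : ℝ) ≤ d := by exact_mod_cast hd
  have h3 : (2 * d - 1 : ℝ) ≠ 0 := by linarith
  rw [integral_roundLaw_cut hd hX hρ, ← hitProb_channel_diff hd]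
  simp only [roundEstimate, Fin.val_zero, Fin.val_one]
  rw [div_mul_eq_mul_div, div_mul_eq_mul_div, ← add_div, div_eq_iff h3]
  ring

theorem memLp_roundEstimate (hd : 2 ≤ d) {X ρ : Op (Fin d × e)} (hX : IsRankOneProj X)
    (hρ : IsDensity ρ) :
    MemLp (roundEstimate d) 2 (roundLaw (cutDist d) (cutChannel d) hX.isHermitian ρ) :=
  (memLp_two_iff_integrable_sq (measurable_roundEstimate d).aestronglyMeasurable).mpr
    (integrable_roundLaw_cut hd hX hρ _)

/-- With `q₀, q₁` the two hit probabilities, the second moment is `(2d - 1)(d q₀ + (d - 1) q₁)`.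
Unbiasedness rewrites the second factor as `Tr(Xρ) + 2 (d - 1) q₁ ≤ 3`. -/
theorem variance_roundEstimate_le (hd : 2 ≤ d) {X ρ : Op (Fin d × e)} (hX : IsRankOneProj X)
    (hρ : IsDensity ρ) :
    Var[roundEstimate d; roundLaw (cutDist d) (cutChannel d) hX.isHermitian ρ] ≤ 6 * d := by
  have hd2 : (2 : ℝ) ≤ d := by exact_mod_cast hd
  have h3 : (0 : ℝ) < 2 * d - 1 := by linarith
  have hP := isProbabilityMeasure_roundLaw (isMPEnsemble_cut hd) hX hρ
  refine (variance_le_expectation_sq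
    (measurable_roundEstimate d).aestronglyMeasurable).trans ?_
  have h : ∫ y, (roundEstimate d ^ 2) y
      ∂(roundLaw (cutDist d) (cutChannel d) hX.isHermitian ρ) =
      (2 * d - 1) * (d * hitProb X (channelZero d) ρ + (d - 1) * hitProb X (channelOne d) ρ) := by
    rw [integral_roundLaw_cut hd hX hρ]
    simp only [roundEstimate, Pi.pow_apply, Fin.val_zero, Fin.val_one]
    field_simp
    ring
  rw [h]
  have h1 := hitProb_channel_diff hd X ρ
  have h2 := hitProb_channelOne_le hd hX hρ
  have h4 := (trace_mul_le hX.posSemidef hρ).trans_eq hX.isDensity.trace_re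
  calc _ ≤ (2 * d - 1 : ℝ) * 3 := by
        gcongr
        linarith
    _ ≤ _ := by linarith

theorem sufficiency (hd : 2 ≤ d) {X : Op (Fin d × e)} (hX : IsRankOneProj X) {ε δ : ℝ}
    (hε : 0 < ε) (hδ0 : 0 < δ) {N : ℕ} (hN : 6 / δ * d / ε ^ 2 ≤ N) :
    Succeeds (cutDist d) (cutChannel d) hX.isHermitian N (meanPost d N) ε δ := by
  intro ρ hρ
  have hd2 : (2 : ℝ) ≤ d := by exact_mod_cast hd
  have hN0 : (0 : ℝ) < N := lt_of_lt_of_le (by positivity) hN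
  have hP := isProbabilityMeasure_roundLaw (isMPEnsemble_cut hd) hX hρ
  set R := roundLaw (cutDist d) (cutChannel d) hX.isHermitian ρ with hR
  set r := (X * ρ).trace.re with hr
  have hL := memLp_roundEstimate hd hX hρ
  set Y : (Fin N → Fin 2 × ℝ) → ℝ := ∑ k : Fin N, fun w => roundEstimate d (w k) with hY
  have hYL : ∀ k : Fin N, MemLp (fun w : Fin N → Fin 2 × ℝ => roundEstimate d (w k)) 2
      (Measure.pi fun _ => R) := fun k => hL.comp_measurePreserving (measurePreserving_eval _ k)
  have hYmem : MemLp Y 2 (Measure.pi fun _ : Fin N => R) :=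
    memLp_finsetSum' _ fun k _ => hYL k
  have hvar : Var[Y; Measure.pi fun _ : Fin N => R] ≤ N * (6 * d) := by
    rw [hY, variance_sum_pi fun _ => hL]
    simp only [Finset.sum_const, Finset.card_univ, Fintype.card_fin, nsmul_eq_mul]
    gcongr
    exact variance_roundEstimate_le hd hX hρ
  have hmean : ∫ w, Y w ∂(Measure.pi fun _ : Fin N => R) = N * r := by
    simp only [hY, Finset.sum_apply]
    rw [integral_finsetSum _ fun k _ => (hYL k).integrable one_le_two]
    have : ∀ k : Fin N, ∫ w, roundEstimate d (w k) ∂(Measure.pi fun _ : Fin N => R) = r :=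
      fun k => by
        rw [integral_comp_eval (μ := fun _ : Fin N => R) (f := roundEstimate d)
          hL.aestronglyMeasurable, integral_roundEstimate hd hX hρ]
    simp [this]
  -- Chebyshev for the unnormalized sum: the deviation is `N ε` and the failure probability at most
  -- `6 d / (N ε²)`.
  have hcheb := meas_ge_le_variance_div_sq hYmem (c := N * ε) (by positivity)
  rw [hmean] at hcheb
  have hbound : Var[Y; Measure.pi fun _ : Fin N => R] / (N * ε) ^ 2 ≤ δ := by
    rw [div_le_iff₀ (by positivity)]
    refine hvar.trans ?_
    rw [div_le_iff₀ (by positivity), div_mul_eq_mul_div, div_le_iff₀ hδ0] at hN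
    calc (N : ℝ) * (6 * d) ≤ N * (N * ε ^ 2 * δ) := by gcongr
      _ = _ := by ring
  have hmean_eq : ∀ w, empiricalMean d N w = Y w / N := fun w => by
    simp [empiricalMean, hY, roundEstimate]
  have hset := measurableSet_estimate r ε
  rw [estimateLaw, meanPost, Measure.deterministic_comp_eq_map,
    Measure.map_apply (measurable_empiricalMean d N) hset]
  have hcompl : (Measure.pi fun _ : Fin N => R)
      (empiricalMean d N ⁻¹' {μ | |μ - r| ≤ ε})ᶜ ≤ ENNReal.ofReal δ := by
    refine (measure_mono fun w hw => ?_).trans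
      (hcheb.trans (ENNReal.ofReal_le_ofReal hbound))
    simp only [Set.mem_compl_iff, Set.mem_preimage, Set.mem_ofPred_eq, not_le, hmean_eq] at hw ⊢
    have : Y w - N * r = N * (Y w / N - r) := by field_simp
    rw [this, abs_mul, abs_of_pos hN0]
    gcongr
  rw [prob_compl_eq_one_sub (measurable_empiricalMean d N hset)] at hcompl
  rw [ENNReal.ofReal_sub _ hδ0.le, ENNReal.ofReal_one]
  exact tsub_le_iff_tsub_le.mp hcompl

end Sufficiency

end TimeLikeCut

/-! ### Assembly with explicit constants -/

theorem mainTheorem4 (δ : ℝ) (hδ0 : 0 < δ) (hδ : δ < 1 / 2) :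
    ∃ c C : ℝ, 0 < c ∧ 0 < C ∧
      ∀ dA dE : ℕ, 2 ≤ dA → 1 ≤ dE →
        -- necessity, for every instance of the procedure
        (∀ (Z : Type*) [MeasurableSpace Z] (p : Measure Z)
            (M : Z → TimeLikeCut.Op (Fin dA) → TimeLikeCut.Op (Fin dA)),
            TimeLikeCut.IsMPEnsemble p M →
            ∃ (X : TimeLikeCut.Op (Fin dA × Fin dE)) (hX : TimeLikeCut.IsRankOneProj X),
              ∀ (ε : ℝ), 0 < ε → ε < 1 / 2 →
                ∀ (N : ℕ) (post : Kernel (Fin N → Z × ℝ) ℝ) [IsMarkovKernel post],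
                  TimeLikeCut.Succeeds p M hX.isHermitian N post ε δ → c * dA ≤ N) ∧
        -- sufficiency, for the ensemble of the optimal cut
        (TimeLikeCut.IsMPEnsemble (TimeLikeCut.cutDist dA) (TimeLikeCut.cutChannel dA) ∧
          ∀ (X : TimeLikeCut.Op (Fin dA × Fin dE)) (hX : TimeLikeCut.IsRankOneProj X)
            (ε : ℝ), 0 < ε →
              ∀ N : ℕ, C * dA / ε ^ 2 ≤ N →
                TimeLikeCut.Succeeds (TimeLikeCut.cutDist dA) (TimeLikeCut.cutChannel dA)
                  hX.isHermitian N (TimeLikeCut.meanPost dA N) ε δ) := by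
  -- The 4 is from the total hit probability `4 / d`, the 6 from the variance bound; `δ < 1 / 2`
  -- makes the first constant positive.
  refine ⟨(1 - 2 * δ) / 4, 6 / δ, by linarith, by positivity, fun dA dE hA hE => ?_⟩
  have : Nonempty (Fin dE) := ⟨⟨0, hE⟩⟩
  refine ⟨fun Z _ p M hM => ?_, TimeLikeCut.isMPEnsemble_cut hA,
    fun X hX ε hε N hN => TimeLikeCut.sufficiency hA hX hε hδ0 hN⟩
  obtain ⟨X, hX, h⟩ :=
    TimeLikeCut.necessity (e := Fin dE) hA hM hδ0.le (by linarith : δ ≤ 1)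
  exact ⟨X, hX, fun ε _ hε N post _ hS => h ε hε N post hS⟩
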